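/- Let $n\ge 1$, $\mathbb C^{\pm}=\{z\in\mathbb C:\pm\operatorname{Im}z>0\}$ and $\mathbb C^{+n}=(\mathbb C^+)^n$. **Herglotz–Nevanlinna functions and symmetric extensions.** A Herglotz–Nevanlinna function is a holomorphic $h\colon\mathbb C^{+n}\to\mathbb C$ with $\operatorname{Im}h\ge 0$. Put $$K_n(z,t)=\mathrm i\left(\frac{2}{(2\mathrm i)^n}\prod_{\ell=1}^n\Big(\frac1{t_\ell-z_\ell}-\frac1{t_\ell+\mathrm i}\Big)-\frac{1}{(2\mathrm i)^n}\prod_{\ell=1}^n\Big(\frac1{t_\ell-\mathrm i}-\frac1{t_\ell+\mathrm i}\Big)\right),\qquad z\in(\mathbb C\setminus\mathbb R)^n,\ t\in\mathbb R^n,$$ and, for $z\in\mathbb C\setminus\mathbb R$ and $t\in\mathbb R$, $$N_{-1}(z,t)=\tfrac1{2\mathrm i}\Big(\tfrac1{t-z}-\tfrac1{t-\mathrm i}\Big),\quad N_0(z,t)=\tfrac1{2\mathrm i}\Big(\tfrac1{t-\mathrm i}-\tfrac1{t+\mathrm i}\Big),\quad N_1(z,t)=\tfrac1{2\mathrm i}\Big(\tfrac1{t+\mathrm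 i}-\tfrac1{t-\bar z}\Big).$$ Every Herglotz–Nevanlinna function $h$ can be written on $\mathbb C^{+n}$, in a unique way, as $$h(z)=a+\sum_{j=1}^n b_jz_j+\frac1{\pi^n}\int_{\mathbb R^n}K_n(z,t)\,d\mu(t),$$ where $a\in\mathbb R$, $b\in[0,\infty)^n$, and $\mu$ is a positive Borel measure on $\mathbb R^n$ with $\int\prod_{\ell=1}^n(1+t_\ell^2)^{-1}\,d\mu(t)<\infty$ and $$\sum_{\rho}\int_{\mathbb R^n}\prod_{j=1}^nN_{\rho_j}(z_j,t_j)\,d\mu(t)=0\qquad\text{for all }z\in\mathbb C^{+n},$$ the sum running over all $\rho\in\{-1,0,1\}^n$ in which both $-1$ and $1$ occur. The symmetric extension $h_{\mathrm{sym}}\colon(\mathbb C\setminus\mathbb R)^n\to\mathbb C$ of $h$ is the function given by the same right-hand side for all $z\in(\mathbb C\setminus\mathbb R)^n$. **Theorem.** Let $f\colon(\mathbb C\setminus\mathbb R)^n\to\mathbb C$ be holomorphic. Suppose that for every $j\in\{1,\dots,n\}$, every choice of the components $z_k\in\mathbb C\setminus\mathbb R$ with $k\ne j$, and every $\theta\in(0,\pi/2]$,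 one has $f(z)/z_j\to 0$ as $|z_j|\to\infty$ within the upper Stolz domain $\{w\in\mathbb C^+:\theta\le\arg w\le\pi-\theta\}$, and also as $|z_j|\to\infty$ within the lower Stolz domain $\{w\in\mathbb C^-:\bar w\text{ lies in the upper Stolz domain}\}$. Then $f=h_{\mathrm{sym}}$ for some Herglotz–Nevanlinna function $h$ if and only if the following three conditions hold: (i) $\operatorname{Im}f(z)\ge 0$ for all $z\in\mathbb C^{+n}$; (ii) for all $z\in(\mathbb C\setminus\mathbb R)^n$, $$f(z)=\sum_{\emptyset\ne B\subseteq\{1,\dots,n\}}(-1)^{|B|+1}\,\overline{f(\zeta^{B})},\qquad \zeta^{B}_j=\begin{cases}\overline{z_j},&j\in B,\\ \mathrm i,&j\notin B;\end{cases}$$ (iii) (variable non-dependence property) whenever $z\in(\mathbb C\setminus\mathbb R)^n$ has some component in $\mathbb C^-$, the value $f(z)$ does not change when components of $z$ that lie in $\mathbb C^+$ are replaced by other points of $\mathbb C^+$. -/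

import Mathlib

open Complex MeasureTheory Filter Topology
open scoped ComplexConjugate

namespace HerglotzNevanlinna

/-- The poly cut-plane `(ℂ ∖ ℝ)ⁿ`. -/
def polyCutPlane (n : ℕ) : Set (Fin n → ℂ) := {z | ∀ j, (z j).im ≠ 0}

/-- The poly-upper half-plane `ℂ⁺ⁿ`. -/
def polyUpperHalfPlane (n : ℕ) : Set (Fin n → ℂ) := {z | ∀ j, 0 < (z j).im}

/-- The map `Ψ_B`: the components of `z` with index in `B` are replaced by the conjugates of the
components of `w`. -/
def selectiveConj {n : ℕ} (B : Finset (Fin n)) (z w : Fin n → ℂ) : Fin n → ℂ :=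
  fun j => if j ∈ B then conj (w j) else z j

/-- The kernel `K_n`. -/
noncomputable def kernel {n : ℕ} (z : Fin n → ℂ) (t : Fin n → ℝ) : ℂ :=
  I * (2 / (2 * I) ^ n * ∏ l, (1 / ((t l : ℂ) - z l) - 1 / ((t l : ℂ) + I))
    - 1 / (2 * I) ^ n * ∏ l, (1 / ((t l : ℂ) - I) - 1 / ((t l : ℂ) + I)))

/-- The factors `N_{-1}`, `N_0`, `N_1`, indexed by the three-element type `{-1, 0, 1}`. -/
noncomputable def nevanlinnaFactor : SignType → ℂ → ℝ → ℂ
  | .neg, z, t => 1 / (2 * I) * (1 / ((t : ℂ) - z) - 1 / ((t : ℂ) - I))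
  | .zero, _, t => 1 / (2 * I) * (1 / ((t : ℂ) - I) - 1 / ((t : ℂ) + I))
  | .pos, z, t => 1 / (2 * I) * (1 / ((t : ℂ) + I) - 1 / ((t : ℂ) - conj z))

/-- The growth condition `∫ ∏ (1 + t_l²)⁻¹ dμ < ∞`. -/
def GrowthCondition {n : ℕ} (μ : Measure (Fin n → ℝ)) : Prop :=
  ∫⁻ t, ENNReal.ofReal (∏ l, 1 / (1 + (t l) ^ 2)) ∂μ < ⊤

/-- The Nevanlinna condition on a measure: the sum runs over all `ρ ∈ {-1, 0, 1}ⁿ` in which both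
`-1` and `1` occur. -/
def NevanlinnaCondition {n : ℕ} (μ : Measure (Fin n → ℝ)) : Prop :=
  ∀ z ∈ polyUpperHalfPlane n,
    ∑ ρ : Fin n → SignType with (∃ j, ρ j = -1) ∧ (∃ j, ρ j = 1),
      ∫ t, ∏ j, nevanlinnaFactor (ρ j) (z j) (t j) ∂μ = 0

/-- A function (given by its values on `ℂ⁺ⁿ`) is Herglotz–Nevanlinna if it is holomorphic with
non-negative imaginary part on `ℂ⁺ⁿ`. -/
structure IsHerglotzNevanlinna {n : ℕ} (h : (Fin n → ℂ) → ℂ) : Prop where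
  holomorphic : DifferentiableOn ℂ h (polyUpperHalfPlane n)
  im_nonneg : ∀ z ∈ polyUpperHalfPlane n, 0 ≤ (h z).im

/-- The right-hand side `a + ∑ b_j z_j + π⁻ⁿ ∫ K_n(z, t) dμ(t)` of the integral representation. -/
noncomputable def integralFormula {n : ℕ} (a : ℝ) (b : Fin n → ℝ) (μ : Measure (Fin n → ℝ))
    (z : Fin n → ℂ) : ℂ :=
  (a : ℂ) + ∑ j, (b j : ℂ) * z j + 1 / (Real.pi : ℂ) ^ n * ∫ t, kernel z t ∂μ

/-- `(a, b, μ)` is a triple of representing parameters of `h`. -/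
structure IsRepresentedBy {n : ℕ} (h : (Fin n → ℂ) → ℂ) (a : ℝ) (b : Fin n → ℝ)
    (μ : Measure (Fin n → ℝ)) : Prop where
  b_nonneg : ∀ j, 0 ≤ b j
  growth : GrowthCondition μ
  nevanlinna : NevanlinnaCondition μ
  eqOn : Set.EqOn h (integralFormula a b μ) (polyUpperHalfPlane n)

/-- `f = h_sym` on `(ℂ ∖ ℝ)ⁿ`: the integral representation of `h`, which holds on `ℂ⁺ⁿ`, is read as
a formula on all of `(ℂ ∖ ℝ)ⁿ`. -/
def IsSymmetricExtension {n : ℕ} (h f : (Fin n → ℂ) → ℂ) : Prop :=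
  ∃ (a : ℝ) (b : Fin n → ℝ) (μ : Measure (Fin n → ℝ)),
    IsRepresentedBy h a b μ ∧ Set.EqOn f (integralFormula a b μ) (polyCutPlane n)

/-- The upper Stolz domain with centre `0` and angle `θ`. -/
def upperStolz (θ : ℝ) : Set ℂ := {z | 0 < z.im ∧ θ ≤ z.arg ∧ z.arg ≤ Real.pi - θ}

/-- The lower Stolz domain with centre `0` and angle `θ`. -/
def lowerStolz (θ : ℝ) : Set ℂ := {z | z.im < 0 ∧ -(Real.pi - θ) ≤ z.arg ∧ z.arg ≤ -θ}

/-- `f(z) / z_j → 0` as `z_j → ∞` in any upper and in any lower Stolz domain, for every `j` and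
every choice of the other components. -/
def HasSublinearGrowth {n : ℕ} (f : (Fin n → ℂ) → ℂ) : Prop :=
  ∀ j, ∀ z ∈ polyCutPlane n, ∀ θ ∈ Set.Ioc 0 (Real.pi / 2),
    Tendsto (fun w => f (Function.update z j w) / w)
      (Bornology.cobounded ℂ ⊓ 𝓟 (upperStolz θ)) (𝓝 0) ∧
    Tendsto (fun w => f (Function.update z j w) / w)
      (Bornology.cobounded ℂ ⊓ 𝓟 (lowerStolz θ)) (𝓝 0)

/-- The symmetry formula
`f(z) = ∑_{B ≠ ∅} (-1)^{|B|+1} conj (f(Ψ_B(i𝟏, z)))` on `(ℂ ∖ ℝ)ⁿ`. -/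
def SymmetryFormula {n : ℕ} (f : (Fin n → ℂ) → ℂ) : Prop :=
  ∀ z ∈ polyCutPlane n,
    f z = ∑ B : Finset (Fin n) with B.Nonempty,
      (-1 : ℂ) ^ (B.card + 1) * conj (f (selectiveConj B (fun _ => I) z))

/-- The variable non-dependence property: if some component of `z` lies in `ℂ⁻`, then changing
components of `z` that lie in `ℂ⁺`, within `ℂ⁺`, does not change the value of `f`. -/
def VariableNonDependence {n : ℕ} (f : (Fin n → ℂ) → ℂ) : Prop :=
  ∀ z ∈ polyCutPlane n, ∀ w ∈ polyCutPlane n, (∃ j, (z j).im < 0) →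
    (∀ k, w k = z k ∨ (0 < (z k).im ∧ 0 < (w k).im)) → f w = f z

end HerglotzNevanlinna

/-!
Write `c = N₋₁ + N₀` for the factor of the first product in `kernel`, so that
`K_n = i (2 ∏ c(z_l, t_l) - ∏ N₀(t_l))`, and let `F_ρ(z) = ∫ ∏ N_{ρ_j}(z_j, t_j) dμ(t)`
(`nevanlinnaIntegral`). The function `F_ρ` is holomorphic, antiholomorphic or constant in `z_j`
according to `ρ_j = -1, 1, 0`, and it vanishes at `z_j = i` if `ρ_j ≠ 0`.

A function of one variable that is both holomorphic and antiholomorphic is constant. Hence the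
antiholomorphic part of a sum of functions `F_ρ` can be isolated, one variable at a time
(`sum_filter_eq_one_eq`). In particular a vanishing sum of functions `F_ρ` vanishes term by term
(`nevanlinnaIntegral_eq_zero_of_sum_eq_zero`), so the Nevanlinna condition says that `F_ρ = 0` for
every `ρ` in which both `-1` and `1` occur.

*Symmetric extensions satisfy the conditions.* If all variables but one are `i`, then the imaginary
part of the kernel is a Poisson kernel, so `Im f(i, …, iy, …, i) ≥ b_j y` and sublinear growth gives
`b = 0`. The symmetry formula then holds for the kernel itself (`kernel_eq_sum_conj`): it is
the expansion of `∏ c = ∏ (N₀ - (N₀ - c))`, since conjugating `c` at `conj z` gives `N₀ - c`. For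
variable non-dependence, expand `∏ c` into Nevanlinna factors, where a variable in the lower
half-plane contributes only `-N₁` and one in the upper half-plane contributes `N₋₁ + N₀`; all terms
containing `N₋₁` integrate to zero (`integral_cauchyFactor_eq`).

*Functions with these properties are symmetric extensions.* By the Cayley transform, `Im f` becomes
a non-negative function on the polydisc. By the iterated Poisson formula and weak compactness it is
the Poisson integral of a finite measure on the torus
(`exists_finiteMeasure_integral_prod_poissonKernel`). A mass at `ω_j = 1`, that is at infinity, would
contradict the sublinear growth, so the measure comes from a measure `μ` on `ℝⁿ`
(`exists_measure_im_eq_integral_poisson`). The Poisson kernel is the product of the sums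
`N₋₁ + N₀ + N₁`, so the imaginary part of `f - π⁻ⁿ ∫ K_n dμ` is `π⁻ⁿ` times the sum of the Nevanlinna
condition. As each term of the latter has a holomorphic and an antiholomorphic factor, the difference
is constant (`eq_const_of_sum_mixedSigns_eq`), and evaluating at `i` shows that the sum vanishes
and that the constant is real. This proves the representation on the poly-upper half-plane. Both `f`
and the right-hand side satisfy the symmetry formula and variable non-dependence, and
these two properties determine a function by its values on the poly-upper half-plane
(`eqOn_polyCutPlane_of_eqOn_polyUpperHalfPlane`).
-/

namespace HerglotzNevanlinna

variable {n : ℕ}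

/-! ### The kernel and its factors -/

/-- The one-variable factor `c(z, t) = (2i)⁻¹ (1 / (t - z) - 1 / (t + i))` of the first product in
`kernel`. -/
noncomputable def cauchyFactor (z : ℂ) (t : ℝ) : ℂ :=
  1 / (2 * I) * (1 / ((t : ℂ) - z) - 1 / ((t : ℂ) + I))

lemma ofReal_sub_ne_zero {z : ℂ} (hz : z.im ≠ 0) (t : ℝ) : (t : ℂ) - z ≠ 0 := by
  intro h
  apply hz
  have := congrArg Complex.im h
  simpa using this

lemma ofReal_add_I_ne_zero (t : ℝ) : (t : ℂ) + I ≠ 0 := by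
  simpa using ofReal_sub_ne_zero (z := -I) (by simp) t

lemma ofReal_sub_I_ne_zero (t : ℝ) : (t : ℂ) - I ≠ 0 :=
  ofReal_sub_ne_zero (by simp) t

lemma kernel_eq (z : Fin n → ℂ) (t : Fin n → ℝ) :
    kernel z t = I * (2 * ∏ l, cauchyFactor (z l) (t l)
      - ∏ l, nevanlinnaFactor .zero (z l) (t l)) := by
  simp only [kernel, cauchyFactor, nevanlinnaFactor, Finset.prod_mul_distrib, Finset.prod_const,
    Finset.card_univ, Fintype.card_fin, one_div, inv_pow]
  ring

lemma nevanlinnaFactor_neg_add_zero (z : ℂ) (t : ℝ) :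
    nevanlinnaFactor .neg z t + nevanlinnaFactor .zero z t = cauchyFactor z t := by
  simp only [cauchyFactor, nevanlinnaFactor]
  ring

lemma nevanlinnaFactor_zero_eq (z : ℂ) (t : ℝ) :
    nevanlinnaFactor .zero z t = ((1 / (1 + t ^ 2) : ℝ) : ℂ) := by
  have h1 := ofReal_add_I_ne_zero t
  have h2 := ofReal_sub_I_ne_zero t
  have h3 : (1 + (t : ℂ) ^ 2) ≠ 0 := by
    have : (1 + (t : ℂ) ^ 2) = (t + I) * (t - I) := by ring_nf; simp; ring
    rw [this]; exact mul_ne_zero h1 h2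
  simp only [nevanlinnaFactor]
  push_cast
  field_simp
  ring_nf
  simp

lemma nevanlinnaFactor_neg_sign (s : SignType) (z : ℂ) (t : ℝ) :
    nevanlinnaFactor (-s) z t = conj (nevanlinnaFactor s z t) := by
  cases s
  · change nevanlinnaFactor .zero z t = conj (nevanlinnaFactor .zero z t)
    rw [nevanlinnaFactor_zero_eq, conj_ofReal]
  · change nevanlinnaFactor .pos z t = _
    simp [nevanlinnaFactor, map_ofNat]
    ring
  · change nevanlinnaFactor .neg z t = _
    simp [nevanlinnaFactor, map_ofNat]
    ring

lemma cauchyFactor_conj (z : ℂ) (t : ℝ) :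
    cauchyFactor (conj z) t = -nevanlinnaFactor .pos z t := by
  simp only [cauchyFactor, nevanlinnaFactor]
  ring

lemma conj_cauchyFactor_conj (z : ℂ) (t : ℝ) :
    conj (cauchyFactor (conj z) t) = nevanlinnaFactor .zero z t - cauchyFactor z t := by
  simp [cauchyFactor, nevanlinnaFactor, map_ofNat]
  ring

lemma cauchyFactor_I (t : ℝ) : cauchyFactor I t = nevanlinnaFactor .zero I t := rfl

lemma nevanlinnaFactor_I {s : SignType} (hs : s ≠ 0) (t : ℝ) : nevanlinnaFactor s I t = 0 := by
  cases s
  · exact absurd rfl hs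
  · simp [nevanlinnaFactor]
  · simp [nevanlinnaFactor]

/-- The three factors add up to the Poisson kernel of the half-plane. -/
lemma sum_nevanlinnaFactor {z : ℂ} (hz : z.im ≠ 0) (t : ℝ) :
    ∑ s, nevanlinnaFactor s z t = ((z.im / ‖(t : ℂ) - z‖ ^ 2 : ℝ) : ℂ) := by
  have h1 := ofReal_sub_ne_zero hz t
  have h2 : (t : ℂ) - conj z ≠ 0 := ofReal_sub_ne_zero (by simpa using hz) t
  have e : ((‖(t : ℂ) - z‖ ^ 2 : ℝ) : ℂ) = (t - z) * (t - conj z) := by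
    push_cast
    rw [← Complex.mul_conj']
    simp
  have e2 : ((z.im : ℝ) : ℂ) = (z - conj z) / (2 * I) := Complex.im_eq_sub_conj z
  have : ∑ s, nevanlinnaFactor s z t = 1 / (2 * I) * (1 / (t - z) - 1 / (t - conj z)) := by
    rw [show (Finset.univ : Finset SignType) = {.zero, .neg, .pos} from rfl]
    simp [nevanlinnaFactor]
    ring
  rw [this, Complex.ofReal_div, e, e2]
  field_simp
  ring

lemma nevanlinnaFactor_measurable (s : SignType) (z : ℂ) : Measurable (nevanlinnaFactor s z) := by
  cases s <;> (unfold nevanlinnaFactor; fun_prop)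

lemma cauchyFactor_measurable (z : ℂ) : Measurable (cauchyFactor z) := by
  unfold cauchyFactor; fun_prop

lemma one_add_sq_le {z : ℂ} {ε M : ℝ} (hε : 0 < ε) (h1 : ε ≤ |z.im|) (h2 : ‖z - I‖ ≤ M) (t : ℝ) :
    1 + t ^ 2 ≤ (1 + M / ε) ^ 2 * ‖(t : ℂ) - z‖ ^ 2 := by
  have h3 : |z.im| ≤ ‖(t : ℂ) - z‖ := by
    simpa using Complex.abs_im_le_norm ((t : ℂ) - z)
  have h4 : ‖(t : ℂ) - I‖ ≤ (1 + M / ε) * ‖(t : ℂ) - z‖ := by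
    calc ‖(t : ℂ) - I‖ = ‖(t - z) + (z - I)‖ := by ring_nf
      _ ≤ ‖(t : ℂ) - z‖ + M := (norm_add_le _ _).trans (by gcongr)
      _ = ‖(t : ℂ) - z‖ + M / ε * ε := by field_simp
      _ ≤ ‖(t : ℂ) - z‖ + M / ε * ‖(t : ℂ) - z‖ := by
        have : 0 ≤ M := (norm_nonneg _).trans h2
        gcongr
        exact h1.trans h3
      _ = _ := by ring
  have h5 : ‖(t : ℂ) - I‖ ^ 2 = 1 + t ^ 2 := by
    rw [← Complex.normSq_eq_norm_sq, Complex.normSq_apply]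
    simp
    ring
  rw [← h5, ← mul_pow]
  gcongr

lemma norm_nevanlinnaFactor_le (s : SignType) {z : ℂ} (hz : z.im ≠ 0) :
    ∃ C, 0 ≤ C ∧ ∀ t : ℝ, ‖nevanlinnaFactor s z t‖ ≤ C * (1 / (1 + t ^ 2)) := by
  have key : ∃ C, 0 ≤ C ∧ ∀ t : ℝ, ‖nevanlinnaFactor .neg z t‖ ≤ C * (1 / (1 + t ^ 2)) := by
    set M := ‖z - I‖
    have hε : 0 < |z.im| := abs_pos.mpr hz
    have hC : 0 ≤ 1 + M / |z.im| := by positivity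
    refine ⟨M * (1 + M / |z.im|), by positivity, fun t => ?_⟩
    have h1 := ofReal_sub_ne_zero hz t
    have h2 := ofReal_sub_I_ne_zero t
    have h3 := one_add_sq_le hε le_rfl le_rfl (z := z) t
    have h5 : ‖(t : ℂ) - I‖ ^ 2 = 1 + t ^ 2 := by
      rw [← Complex.normSq_eq_norm_sq, Complex.normSq_apply]
      simp
      ring
    have h4 : ‖(t : ℂ) - I‖ ≤ (1 + M / |z.im|) * ‖(t : ℂ) - z‖ := by
      rw [← h5, ← mul_pow] at h3
      exact le_of_sq_le_sq h3 (by positivity)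
    have e : nevanlinnaFactor .neg z t = 1 / (2 * I) * (z - I) / ((t - z) * (t - I)) := by
      simp only [nevanlinnaFactor]
      field_simp
      ring
    have hp1 : 0 < ‖(t : ℂ) - z‖ := norm_pos_iff.mpr h1
    have hp2 : 0 < ‖(t : ℂ) - I‖ := norm_pos_iff.mpr h2
    rw [e, norm_div, norm_mul, norm_mul, ← h5, mul_one_div]
    rw [div_le_div_iff₀ (by positivity) (by positivity)]
    have e2 : ‖1 / (2 * I)‖ = 1 / 2 := by simp
    rw [e2]
    have hM : 0 ≤ M := norm_nonneg _
    calc 1 / 2 * M * ‖(t : ℂ) - I‖ ^ 2 ≤ M * (‖(t : ℂ) - I‖ * ‖(t : ℂ) - I‖) := by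
          rw [← sq]; nlinarith [mul_nonneg hM (sq_nonneg ‖(t : ℂ) - I‖)]
      _ ≤ M * (((1 + M / |z.im|) * ‖(t : ℂ) - z‖) * ‖(t : ℂ) - I‖) := by gcongr
      _ = _ := by ring
  cases s
  · refine ⟨1, zero_le_one, fun t => ?_⟩
    rw [nevanlinnaFactor_zero_eq, Complex.norm_real, one_mul, Real.norm_of_nonneg (by positivity)]
  · exact key
  · obtain ⟨C, h0, hC⟩ := key
    refine ⟨C, h0, fun t => ?_⟩
    have := nevanlinnaFactor_neg_sign .neg z t
    change nevanlinnaFactor .pos z t = _ at this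
    rw [this, Complex.norm_conj]
    exact hC t

lemma norm_cauchyFactor_le {z : ℂ} (hz : z.im ≠ 0) :
    ∃ C, 0 ≤ C ∧ ∀ t : ℝ, ‖cauchyFactor z t‖ ≤ C * (1 / (1 + t ^ 2)) := by
  obtain ⟨C, h0, hC⟩ := norm_nevanlinnaFactor_le .neg hz
  obtain ⟨D, h0', hD⟩ := norm_nevanlinnaFactor_le .zero hz
  refine ⟨C + D, by positivity, fun t => ?_⟩
  rw [← nevanlinnaFactor_neg_add_zero, add_mul]
  exact (norm_add_le _ _).trans (add_le_add (hC t) (hD t))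

lemma GrowthCondition.integrable_weight {μ : Measure (Fin n → ℝ)} (hμ : GrowthCondition μ) :
    Integrable (fun t : Fin n → ℝ => ∏ l, 1 / (1 + (t l) ^ 2)) μ := by
  refine ⟨Measurable.aestronglyMeasurable (by fun_prop), ?_⟩
  rw [hasFiniteIntegral_iff_ofReal]
  · exact hμ
  · exact ae_of_all _ fun t => Finset.prod_nonneg fun l _ => by positivity

lemma GrowthCondition.integrable_prod {μ : Measure (Fin n → ℝ)} (hμ : GrowthCondition μ)
    {φ : Fin n → ℝ → ℂ} (hm : ∀ j, Measurable (φ j))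
    (hφ : ∀ j, ∃ C, 0 ≤ C ∧ ∀ t : ℝ, ‖φ j t‖ ≤ C * (1 / (1 + t ^ 2))) :
    Integrable (fun t : Fin n → ℝ => ∏ j, φ j (t j)) μ := by
  choose C hC0 hC using hφ
  refine (hμ.integrable_weight.const_mul (∏ j, C j)).mono' ?_ ?_
  · refine Measurable.aestronglyMeasurable ?_
    exact Finset.measurable_prod _ fun j _ => (hm j).comp (measurable_pi_apply j)
  · refine ae_of_all _ fun t => ?_
    rw [norm_prod, ← Finset.prod_mul_distrib]
    exact Finset.prod_le_prod (fun _ _ => norm_nonneg _) fun j _ => hC j (t j)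

/-- The integrals `∫ ∏ N_{ρ_j}(z_j, t_j) dμ(t)` of which the Nevanlinna condition is made. -/
noncomputable def nevanlinnaIntegral (μ : Measure (Fin n → ℝ)) (ρ : Fin n → SignType)
    (z : Fin n → ℂ) : ℂ :=
  ∫ t, ∏ j, nevanlinnaFactor (ρ j) (z j) (t j) ∂μ

lemma GrowthCondition.integrable_nevanlinna {μ : Measure (Fin n → ℝ)} (hμ : GrowthCondition μ)
    (ρ : Fin n → SignType) {z : Fin n → ℂ} (hz : z ∈ polyCutPlane n) :
    Integrable (fun t : Fin n → ℝ => ∏ j, nevanlinnaFactor (ρ j) (z j) (t j)) μ :=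
  hμ.integrable_prod (fun _ => nevanlinnaFactor_measurable _ _)
    fun j => norm_nevanlinnaFactor_le _ (hz j)

lemma GrowthCondition.integrable_cauchy {μ : Measure (Fin n → ℝ)} (hμ : GrowthCondition μ)
    {z : Fin n → ℂ} (hz : z ∈ polyCutPlane n) :
    Integrable (fun t : Fin n → ℝ => ∏ j, cauchyFactor (z j) (t j)) μ :=
  hμ.integrable_prod (fun _ => cauchyFactor_measurable _)
    fun j => norm_cauchyFactor_le (hz j)

lemma GrowthCondition.integrable_kernel {μ : Measure (Fin n → ℝ)} (hμ : GrowthCondition μ)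
    {z : Fin n → ℂ} (hz : z ∈ polyCutPlane n) : Integrable (kernel z) μ := by
  have : kernel z = fun t => I * (2 * ∏ l, cauchyFactor (z l) (t l)
      - ∏ l, nevanlinnaFactor .zero (z l) (t l)) := funext (kernel_eq z)
  rw [this]
  exact (((hμ.integrable_cauchy hz).const_mul 2).sub
    (hμ.integrable_nevanlinna (fun _ => .zero) hz)).const_mul I

lemma polyUpperHalfPlane_subset : polyUpperHalfPlane n ⊆ polyCutPlane n :=
  fun _ hz j => (hz j).ne'

lemma update_mem_polyUpperHalfPlane {z : Fin n → ℂ} (hz : z ∈ polyUpperHalfPlane n) (k : Fin n)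
    {w : ℂ} (hw : 0 < w.im) : Function.update z k w ∈ polyUpperHalfPlane n := by
  intro j
  rcases eq_or_ne j k with rfl | h
  · simpa using hw
  · simpa [h] using hz j

lemma nevanlinnaIntegral_neg (μ : Measure (Fin n → ℝ)) (ρ : Fin n → SignType) (z : Fin n → ℂ) :
    nevanlinnaIntegral μ (-ρ) z = conj (nevanlinnaIntegral μ ρ z) := by
  simp only [nevanlinnaIntegral, ← integral_conj, map_prod, Pi.neg_apply,
    nevanlinnaFactor_neg_sign]

lemma nevanlinnaIntegral_update_of_eq_zero (μ : Measure (Fin n → ℝ)) {ρ : Fin n → SignType}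
    {k : Fin n} (hk : ρ k = 0) (z : Fin n → ℂ) (w : ℂ) :
    nevanlinnaIntegral μ ρ (Function.update z k w) = nevanlinnaIntegral μ ρ z := by
  simp only [nevanlinnaIntegral]
  refine integral_congr_ae (ae_of_all _ fun t => Finset.prod_congr rfl fun j _ => ?_)
  rcases eq_or_ne j k with rfl | h
  · rw [hk]; rfl
  · simp [h]

lemma nevanlinnaIntegral_update_I (μ : Measure (Fin n → ℝ)) {ρ : Fin n → SignType}
    {k : Fin n} (hk : ρ k ≠ 0) (z : Fin n → ℂ) :
    nevanlinnaIntegral μ ρ (Function.update z k I) = 0 := by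
  simp only [nevanlinnaIntegral]
  rw [integral_eq_zero_of_ae]
  refine ae_of_all _ fun t => ?_
  exact Finset.prod_eq_zero (Finset.mem_univ k) (by simp [nevanlinnaFactor_I hk])

lemma differentiableAt_nevanlinnaIntegral {μ : Measure (Fin n → ℝ)} (hμ : GrowthCondition μ)
    {ρ : Fin n → SignType} {k : Fin n} (hk : ρ k ≠ 1) {z : Fin n → ℂ}
    (hz : z ∈ polyUpperHalfPlane n) {w : ℂ} (hw : 0 < w.im) :
    DifferentiableAt ℂ (fun w => nevanlinnaIntegral μ ρ (Function.update z k w)) w := by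
  rcases hs : ρ k with _ | _ | _
  · simp_rw [nevanlinnaIntegral_update_of_eq_zero μ hs]
    exact differentiableAt_const _
  swap
  · exact absurd hs hk
  set ε := w.im / 2 with hε
  have hε0 : 0 < ε := by positivity
  set M := ‖w - I‖ + ε
  set C := (1 + M / ε) ^ 2
  have hball : ∀ x ∈ Metric.ball w ε, ε ≤ |x.im| ∧ ‖x - I‖ ≤ M := by
    intro x hx
    rw [mem_ball_iff_norm] at hx
    constructor
    · have := (Complex.abs_im_le_norm (x - w)).trans hx.le
      rw [Complex.sub_im, abs_le] at this
      exact le_trans (by linarith) (le_abs_self _)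
    · calc ‖x - I‖ = ‖(x - w) + (w - I)‖ := by ring_nf
        _ ≤ ‖x - w‖ + ‖w - I‖ := norm_add_le _ _
        _ ≤ M := by simp only [M]; linarith
  -- all factors but the one with index `k`
  let φ : (Fin n → ℝ) → ℂ := fun t => ∏ j ∈ Finset.univ.erase k, nevanlinnaFactor (ρ j) (z j) (t j)
  have hφm : Measurable φ := Finset.measurable_prod _ fun j _ =>
    (nevanlinnaFactor_measurable _ _).comp (measurable_pi_apply j)
  have hF : ∀ x t, ∏ j, nevanlinnaFactor (ρ j) (Function.update z k x j) (t j) =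
      1 / (2 * I) * (1 / ((t k : ℂ) - x) - 1 / ((t k : ℂ) - I)) * φ t := by
    intro x t
    rw [← Finset.mul_prod_erase _ _ (Finset.mem_univ k)]
    congr 1
    · rw [hs]; simp [nevanlinnaFactor]
    · refine Finset.prod_congr rfl fun j hj => ?_
      rw [Function.update_of_ne (Finset.ne_of_mem_erase hj)]
  choose B hB0 hB using fun j => norm_nevanlinnaFactor_le (ρ j) (hz j).ne'
  have hD := hasDerivAt_integral_of_dominated_loc_of_deriv_le (μ := μ) (𝕜 := ℂ) (x₀ := w)
    (s := Metric.ball w ε)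
    (F := fun x t => ∏ j, nevanlinnaFactor (ρ j) (Function.update z k x j) (t j))
    (F' := fun x t => 1 / (2 * I) * (1 / ((t k : ℂ) - x) ^ 2) * φ t)
    (bound := fun t => C * (∏ j ∈ Finset.univ.erase k, B j) * ∏ l, 1 / (1 + (t l) ^ 2))
    (Metric.ball_mem_nhds w hε0) ?_ ?_ ?_ ?_ ?_ ?_
  · exact hD.2.differentiableAt
  · refine Eventually.of_forall fun x => Measurable.aestronglyMeasurable ?_
    exact Finset.measurable_prod _ fun j _ =>
      (nevanlinnaFactor_measurable _ _).comp (measurable_pi_apply j)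
  · exact hμ.integrable_nevanlinna ρ
      (polyUpperHalfPlane_subset (update_mem_polyUpperHalfPlane hz k hw))
  · exact Measurable.aestronglyMeasurable (by fun_prop)
  · refine ae_of_all _ fun t x hx => ?_
    obtain ⟨h1, h2⟩ := hball x hx
    have h3 := one_add_sq_le hε0 h1 h2 (t k)
    have hx0 : x.im ≠ 0 := abs_pos.mp (hε0.trans_le h1)
    have hp : 0 < ‖(t k : ℂ) - x‖ := norm_pos_iff.mpr (ofReal_sub_ne_zero hx0 _)
    rw [← Finset.mul_prod_erase _ _ (Finset.mem_univ k), norm_mul, norm_mul]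
    have hφ : ‖φ t‖ ≤ (∏ j ∈ Finset.univ.erase k, B j) *
        ∏ j ∈ Finset.univ.erase k, (1 / (1 + (t j) ^ 2)) := by
      rw [norm_prod, ← Finset.prod_mul_distrib]
      exact Finset.prod_le_prod (fun _ _ => norm_nonneg _) fun j _ => hB j (t j)
    have h4 : ‖1 / (2 * I)‖ * ‖1 / ((t k : ℂ) - x) ^ 2‖ ≤ C * (1 / (1 + (t k) ^ 2)) := by
      have e2 : ‖1 / (2 * I)‖ = 1 / 2 := by simp
      rw [e2, norm_div, norm_pow, norm_one, mul_one_div, mul_one_div,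
        div_le_div_iff₀ (by positivity) (by positivity)]
      nlinarith [sq_nonneg (t k)]
    calc _ ≤ C * (1 / (1 + (t k) ^ 2)) * ((∏ j ∈ Finset.univ.erase k, B j) *
        ∏ j ∈ Finset.univ.erase k, (1 / (1 + (t j) ^ 2))) := by
          gcongr
      _ = _ := by ring
  · exact hμ.integrable_weight.const_mul _
  · refine ae_of_all _ fun t x hx => ?_
    have hx0 : x.im ≠ 0 := abs_pos.mp (hε0.trans_le (hball x hx).1)
    have hne := ofReal_sub_ne_zero hx0 (t k)
    simp_rw [hF]
    have h1 : HasDerivAt (fun x : ℂ => 1 / ((t k : ℂ) - x)) (1 / ((t k : ℂ) - x) ^ 2) x := by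
      have := ((hasDerivAt_id x).const_sub (t k : ℂ)).fun_inv hne
      simpa [one_div] using this
    exact ((h1.sub_const _).const_mul _).mul_const _

/-! ### Separating holomorphic and antiholomorphic dependence -/

/-- A function on the upper half-plane that is holomorphic and the conjugate of a holomorphic
function is constant. -/
lemma eq_of_differentiableAt_of_differentiableAt_conj {g : ℂ → ℂ}
    (hg : ∀ w : ℂ, 0 < w.im → DifferentiableAt ℂ g w)
    (hg' : ∀ w : ℂ, 0 < w.im → DifferentiableAt ℂ (fun w => conj (g w)) w)
    {w₁ w₂ : ℂ} (h₁ : 0 < w₁.im) (h₂ : 0 < w₂.im) : g w₁ = g w₂ := by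
  have hd : ∀ w ∈ {w : ℂ | 0 < w.im}, fderivWithin ℂ g {w : ℂ | 0 < w.im} w = 0 := by
    intro w hw
    have hopen : IsOpen {w : ℂ | 0 < w.im} := isOpen_lt continuous_const Complex.continuous_im
    rw [fderivWithin_of_isOpen hopen hw]
    have e1 : HasFDerivAt g ((fderiv ℂ g w).restrictScalars ℝ) w :=
      (hg w hw).hasFDerivAt.restrictScalars ℝ
    have e2 : HasFDerivAt (fun w => conj (g w))
        ((fderiv ℂ (fun w => conj (g w)) w).restrictScalars ℝ) w :=
      (hg' w hw).hasFDerivAt.restrictScalars ℝ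
    have e3 : HasFDerivAt (fun w => conj (g w))
        ((conjCLE : ℂ →L[ℝ] ℂ).comp ((fderiv ℂ g w).restrictScalars ℝ)) w :=
      (conjCLE : ℂ →L[ℝ] ℂ).hasFDerivAt.comp w e1
    have e4 := e2.unique e3
    -- the derivative of `conj ∘ g` is both complex linear and complex antilinear
    have e5 : ∀ v, fderiv ℂ (fun w => conj (g w)) w v = conj (fderiv ℂ g w v) := by
      intro v
      simpa using congrArg (fun L : ℂ →L[ℝ] ℂ => L v) e4
    have e6 := e5 I
    have e7 := e5 1
    have l1 : fderiv ℂ (fun w => conj (g w)) w I = I * fderiv ℂ (fun w => conj (g w)) w 1 := by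
      rw [← smul_eq_mul, ← map_smul, smul_eq_mul, mul_one]
    have l2 : fderiv ℂ g w I = I * fderiv ℂ g w 1 := by
      rw [← smul_eq_mul, ← map_smul, smul_eq_mul, mul_one]
    rw [l1, l2, e7, map_mul, conj_I] at e6
    have e8 : I * conj (fderiv ℂ g w 1) = 0 := by linear_combination e6 / 2
    have e9 : fderiv ℂ g w 1 = 0 := by simpa using e8
    exact ContinuousLinearMap.ext_ring (by simp [e9])
  have hconv : Convex ℝ {w : ℂ | 0 < w.im} := convex_halfSpace_im_gt 0
  exact hconv.is_const_of_fderivWithin_eq_zero (𝕜 := ℂ)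
    (fun w hw => (hg w hw).differentiableWithinAt) hd h₁ h₂

/-- If a sum of functions `nevanlinnaIntegral μ ρ` equals `L + conj L'`, where `L` and `L'` are
holomorphic in the `k`-th variable, then the terms that are antiholomorphic in this variable add up
to the part of `conj L'` that depends on it. -/
lemma sum_filter_eq_one_eq {μ : Measure (Fin n → ℝ)} (hμ : GrowthCondition μ)
    {R : Finset (Fin n → SignType)} {L L' : (Fin n → ℂ) → ℂ} {k : Fin n}
    (hL : ∀ z ∈ polyUpperHalfPlane n, ∀ w : ℂ, 0 < w.im →
      DifferentiableAt ℂ (fun w => L (Function.update z k w)) w)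
    (hL' : ∀ z ∈ polyUpperHalfPlane n, ∀ w : ℂ, 0 < w.im →
      DifferentiableAt ℂ (fun w => L' (Function.update z k w)) w)
    (hR : ∀ z ∈ polyUpperHalfPlane n,
      ∑ ρ ∈ R, nevanlinnaIntegral μ ρ z = L z + conj (L' z)) :
    ∀ z ∈ polyUpperHalfPlane n, ∑ ρ ∈ R with ρ k = 1, nevanlinnaIntegral μ ρ z =
      conj (L' z - L' (Function.update z k I)) := by
  intro z hz
  set h : ℂ → ℂ := fun w => ∑ ρ ∈ R with ρ k = 1, nevanlinnaIntegral μ ρ (Function.update z k w)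
    - conj (L' (Function.update z k w) - L' (Function.update z k I)) with hh
  set g : ℂ → ℂ := fun w => L (Function.update z k w) - L (Function.update z k I)
    - ∑ ρ ∈ R with ρ k = -1, nevanlinnaIntegral μ ρ (Function.update z k w) with hg
  have hI1 : ∑ ρ ∈ R with ρ k = 1, nevanlinnaIntegral μ ρ (Function.update z k I) = 0 :=
    Finset.sum_eq_zero fun ρ hρ =>
      nevanlinnaIntegral_update_I μ (by rw [(Finset.mem_filter.mp hρ).2]; decide) z
  have hI2 : ∑ ρ ∈ R with ρ k = -1, nevanlinnaIntegral μ ρ (Function.update z k I) = 0 :=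
    Finset.sum_eq_zero fun ρ hρ =>
      nevanlinnaIntegral_update_I μ (by rw [(Finset.mem_filter.mp hρ).2]; decide) z
  have hI : h I = 0 := by simp [hh, hI1]
  have split : ∀ w, ∑ ρ ∈ R, nevanlinnaIntegral μ ρ (Function.update z k w) =
      ∑ ρ ∈ R with ρ k = 1, nevanlinnaIntegral μ ρ (Function.update z k w)
        + ∑ ρ ∈ R with ρ k = -1, nevanlinnaIntegral μ ρ (Function.update z k w)
        + ∑ ρ ∈ R with ρ k = 0, nevanlinnaIntegral μ ρ z := by
    intro w
    simp only [Finset.sum_filter, ← Finset.sum_add_distrib]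
    refine Finset.sum_congr rfl fun ρ _ => ?_
    rcases hs : ρ k with _ | _ | _
    · simp [nevanlinnaIntegral_update_of_eq_zero μ hs]
    · simp
    · simp
  have hgh : ∀ w : ℂ, 0 < w.im → h w = g w := by
    intro w hw
    have h1 := hR _ (update_mem_polyUpperHalfPlane hz k hw)
    have h2 := hR _ (update_mem_polyUpperHalfPlane hz k (w := I) (by simp))
    rw [split] at h1 h2
    rw [hI1, hI2] at h2
    simp only [hg, hh, map_sub]
    linear_combination h1 - h2
  have hgd : ∀ w : ℂ, 0 < w.im → DifferentiableAt ℂ g w := by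
    intro w hw
    refine ((hL z hz w hw).sub_const _).sub (DifferentiableAt.fun_sum fun ρ hρ => ?_)
    exact differentiableAt_nevanlinnaIntegral hμ
      (by rw [(Finset.mem_filter.mp hρ).2]; decide) hz hw
  have hhd : ∀ w : ℂ, 0 < w.im → DifferentiableAt ℂ h w := by
    intro w hw
    refine (hgd w hw).congr_of_eventuallyEq ?_
    have hopen : IsOpen {w : ℂ | 0 < w.im} := isOpen_lt continuous_const Complex.continuous_im
    filter_upwards [hopen.mem_nhds hw] with x hx using hgh x hx
  have hhc : ∀ w : ℂ, 0 < w.im → DifferentiableAt ℂ (fun w => conj (h w)) w := by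
    intro w hw
    simp only [h, map_sub, map_sum, conj_conj, ← nevanlinnaIntegral_neg]
    refine (DifferentiableAt.fun_sum fun ρ hρ => ?_).sub ((hL' z hz w hw).sub_const _)
    refine differentiableAt_nevanlinnaIntegral hμ ?_ hz hw
    rw [Pi.neg_apply, (Finset.mem_filter.mp hρ).2]; decide
  have := eq_of_differentiableAt_of_differentiableAt_conj hhd hhc (hz k) (w₂ := I) (by simp)
  rw [hI] at this
  simpa [h, sub_eq_zero] using this

lemma sum_filter_eq_one_eq_zero {μ : Measure (Fin n → ℝ)} (hμ : GrowthCondition μ)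
    {R : Finset (Fin n → SignType)} {L : (Fin n → ℂ) → ℂ} {k : Fin n}
    (hL : ∀ z ∈ polyUpperHalfPlane n, ∀ w : ℂ, 0 < w.im →
      DifferentiableAt ℂ (fun w => L (Function.update z k w)) w)
    (hR : ∀ z ∈ polyUpperHalfPlane n, ∑ ρ ∈ R, nevanlinnaIntegral μ ρ z = L z) :
    ∀ z ∈ polyUpperHalfPlane n, ∑ ρ ∈ R with ρ k = 1, nevanlinnaIntegral μ ρ z = 0 := by
  intro z hz
  simpa using sum_filter_eq_one_eq hμ (L' := fun _ => 0) hL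
    (fun _ _ _ _ => differentiableAt_const _) (by simpa using hR) z hz

/-- If a sum of functions `nevanlinnaIntegral μ ρ` is holomorphic, then the terms with an
antiholomorphic factor can be omitted. -/
lemma sum_filter_forall_ne_one_eq {μ : Measure (Fin n → ℝ)} (hμ : GrowthCondition μ)
    {R : Finset (Fin n → SignType)} {L : (Fin n → ℂ) → ℂ}
    (hL : ∀ k, ∀ z ∈ polyUpperHalfPlane n, ∀ w : ℂ, 0 < w.im →
      DifferentiableAt ℂ (fun w => L (Function.update z k w)) w)
    (hR : ∀ z ∈ polyUpperHalfPlane n, ∑ ρ ∈ R, nevanlinnaIntegral μ ρ z = L z) :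
    ∀ z ∈ polyUpperHalfPlane n, ∑ ρ ∈ R with ∀ k, ρ k ≠ 1, nevanlinnaIntegral μ ρ z = L z := by
  suffices ∀ s : Finset (Fin n), ∀ z ∈ polyUpperHalfPlane n,
      ∑ ρ ∈ R with ∀ k ∈ s, ρ k ≠ 1, nevanlinnaIntegral μ ρ z = L z by
    simpa using this Finset.univ
  intro s
  induction s using Finset.induction_on with
  | empty => simpa using hR
  | insert k s _ ih =>
    intro z hz
    have h1 := sum_filter_eq_one_eq_zero hμ (hL k) ih z hz
    have h2 := ih z hz
    rw [← Finset.sum_filter_add_sum_filter_not _ (fun ρ => ρ k = 1), h1, zero_add,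
      Finset.filter_filter] at h2
    rw [← h2]
    congr 1
    ext ρ
    simp only [Finset.mem_filter, Finset.mem_insert, forall_eq_or_imp]
    tauto

/-- A vanishing sum of functions `nevanlinnaIntegral μ ρ` vanishes term by term, since no two of
them depend holomorphically, antiholomorphically and not at all on the same variables. -/
lemma nevanlinnaIntegral_eq_zero_of_sum_eq_zero {μ : Measure (Fin n → ℝ)}
    (hμ : GrowthCondition μ) {R : Finset (Fin n → SignType)}
    (hR : ∀ z ∈ polyUpperHalfPlane n, ∑ ρ ∈ R, nevanlinnaIntegral μ ρ z = 0)
    {σ : Fin n → SignType} (hσ : σ ∈ R) {z : Fin n → ℂ} (hz : z ∈ polyUpperHalfPlane n) :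
    nevanlinnaIntegral μ σ z = 0 := by
  have pos : ∀ (R : Finset (Fin n → SignType)) (k : Fin n),
      (∀ z ∈ polyUpperHalfPlane n, ∑ ρ ∈ R, nevanlinnaIntegral μ ρ z = 0) →
      ∀ z ∈ polyUpperHalfPlane n, ∑ ρ ∈ R with ρ k = 1, nevanlinnaIntegral μ ρ z = 0 :=
    fun R k h => sum_filter_eq_one_eq_zero hμ (L := fun _ => 0)
      (fun _ _ _ _ => differentiableAt_const _) h
  have neg : ∀ (R : Finset (Fin n → SignType)) (k : Fin n),
      (∀ z ∈ polyUpperHalfPlane n, ∑ ρ ∈ R, nevanlinnaIntegral μ ρ z = 0) →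
      ∀ z ∈ polyUpperHalfPlane n, ∑ ρ ∈ R with ρ k = -1, nevanlinnaIntegral μ ρ z = 0 := by
    intro R k h z hz
    have h1 := pos (R.map (Equiv.neg _).toEmbedding) k (fun z hz => by
      simp only [Finset.sum_map, Equiv.coe_toEmbedding, Equiv.neg_apply, nevanlinnaIntegral_neg,
        ← map_sum]
      rw [h z hz, map_zero]) z hz
    simp only [Finset.filter_map, Finset.sum_map, Equiv.coe_toEmbedding, Equiv.neg_apply,
      nevanlinnaIntegral_neg, ← map_sum, map_eq_zero] at h1
    rw [← h1]
    congr 1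
    ext ρ
    simp only [Finset.mem_filter, Function.comp_apply, Pi.neg_apply]
    generalize ρ k = s
    revert s
    simp +contextual [neg_eq_iff_eq_neg]
  have all : ∀ s : Finset (Fin n), ∀ z ∈ polyUpperHalfPlane n,
      ∑ ρ ∈ R with ∀ k ∈ s, ρ k = σ k, nevanlinnaIntegral μ ρ z = 0 := by
    intro s
    induction s using Finset.induction_on with
    | empty => simpa using hR
    | insert k s _ ih =>
      intro z hz
      have h1 := pos _ k ih z hz
      have h2 := neg _ k ih z hz
      have h3 := ih z hz
      have e : (R.filter fun ρ => ∀ j ∈ insert k s, ρ j = σ j) =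
          (R.filter fun ρ => ∀ j ∈ s, ρ j = σ j).filter fun ρ => ρ k = σ k := by
        ext ρ
        simp only [Finset.mem_filter, Finset.mem_insert, forall_eq_or_imp]
        tauto
      rw [e]
      generalize R.filter (fun ρ => ∀ j ∈ s, ρ j = σ j) = R' at h1 h2 h3
      rcases hs : σ k with _ | _ | _
      · have h4 : ∑ ρ ∈ R' with ρ k = 0, nevanlinnaIntegral μ ρ z
            + ∑ ρ ∈ R' with ρ k = -1, nevanlinnaIntegral μ ρ z
            + ∑ ρ ∈ R' with ρ k = 1, nevanlinnaIntegral μ ρ z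
            = ∑ ρ ∈ R', nevanlinnaIntegral μ ρ z := by
          simp only [Finset.sum_filter, ← Finset.sum_add_distrib]
          refine Finset.sum_congr rfl fun ρ _ => ?_
          rcases ρ k with _ | _ | _ <;> simp
        rwa [h1, h2, h3, add_zero, add_zero] at h4
      · exact h2
      · exact h1
  have h := all Finset.univ z hz
  rwa [Finset.sum_eq_single_of_mem σ (by simp [hσ])] at h
  intro ρ hρ hne
  exact absurd (funext fun k => (Finset.mem_filter.mp hρ).2 k (Finset.mem_univ k)) hne

/-! ### Sublinear growth excludes a linear term -/

/-- Along the imaginary axis in one variable, sublinear growth bounds the imaginary part. -/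
lemma HasSublinearGrowth.tendsto_im_div {f : (Fin n → ℂ) → ℂ} (hf : HasSublinearGrowth f)
    (j : Fin n) {z : Fin n → ℂ} (hz : z ∈ polyCutPlane n) :
    Tendsto (fun y : ℝ => (f (Function.update z j (y * I))).im / y) atTop (𝓝 0) := by
  have h1 := (hf j z hz (Real.pi / 2) ⟨by positivity, le_rfl⟩).1
  have h2 : Tendsto (fun y : ℝ => (y : ℂ) * I) atTop
      (Bornology.cobounded ℂ ⊓ 𝓟 (upperStolz (Real.pi / 2))) := by
    refine tendsto_inf.mpr ⟨?_, tendsto_principal.mpr ?_⟩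
    · rw [← tendsto_norm_atTop_iff_cobounded]
      simpa using tendsto_abs_atTop_atTop
    · filter_upwards [eventually_gt_atTop 0] with y hy
      have : ((y : ℂ) * I).arg = Real.pi / 2 := by
        rw [Complex.arg_real_mul _ hy, Complex.arg_I]
      refine ⟨by simpa using hy, this.ge, ?_⟩
      rw [this]; linarith
  have h3 := (Complex.continuous_re.tendsto 0).comp (h1.comp h2)
  rw [Complex.zero_re] at h3
  refine h3.congr' ?_
  filter_upwards [eventually_gt_atTop 0] with y hy
  simp only [Function.comp_apply]
  rw [show f (Function.update z j (y * I)) / (y * I)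
    = (-I * f (Function.update z j (y * I))) / (y : ℂ) by
      have : (y : ℂ) ≠ 0 := by exact_mod_cast hy.ne'
      field_simp
      ring_nf
      simp]
  rw [Complex.div_ofReal_re]
  simp

lemma I_mem_polyUpperHalfPlane : (fun _ => I) ∈ polyUpperHalfPlane n := fun _ => by simp

/-- If all variables but one are equal to `i`, then the imaginary part of the kernel is a Poisson
kernel. -/
lemma kernel_update_I_im_nonneg (j : Fin n) {y : ℝ} (hy : 0 < y) (t : Fin n → ℝ) :
    0 ≤ (kernel (Function.update (fun _ => I) j (y * I)) t).im := by
  set w : ℂ := y * I with hw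
  have hwim : w.im ≠ 0 := by simpa [hw] using hy.ne'
  set E : ℝ := ∏ l ∈ Finset.univ.erase j, 1 / (1 + (t l) ^ 2)
  have hE : 0 ≤ E := Finset.prod_nonneg fun l _ => by positivity
  have h1 : ∏ l, cauchyFactor (Function.update (fun _ => I) j w l) (t l) =
      cauchyFactor w (t j) * E := by
    rw [← Finset.mul_prod_erase _ _ (Finset.mem_univ j), Complex.ofReal_prod]
    congr 1
    · simp
    · refine Finset.prod_congr rfl fun l hl => ?_
      rw [Function.update_of_ne (Finset.ne_of_mem_erase hl), cauchyFactor_I,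
        nevanlinnaFactor_zero_eq]
  have h2 : ∏ l, nevanlinnaFactor .zero (Function.update (fun _ => I) j w l) (t l) =
      nevanlinnaFactor .zero w (t j) * E := by
    rw [← Finset.mul_prod_erase _ _ (Finset.mem_univ j), Complex.ofReal_prod]
    congr 1
    refine Finset.prod_congr rfl fun l hl => ?_
    rw [nevanlinnaFactor_zero_eq]
  have h3 := sum_nevanlinnaFactor hwim (t j)
  rw [show (Finset.univ : Finset SignType) = {.zero, .neg, .pos} from rfl] at h3
  have h4 : nevanlinnaFactor .pos w (t j) = conj (nevanlinnaFactor .neg w (t j)) :=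
    nevanlinnaFactor_neg_sign .neg w (t j)
  have h5 : (2 * cauchyFactor w (t j) - nevanlinnaFactor .zero w (t j)).re
      = w.im / ‖((t j : ℝ) : ℂ) - w‖ ^ 2 := by
    have := congrArg Complex.re h3
    rw [Complex.ofReal_re] at this
    rw [← this, ← nevanlinnaFactor_neg_add_zero, Finset.sum_insert (by decide),
      Finset.sum_insert (by decide), Finset.sum_singleton, h4]
    simp
    ring
  rw [kernel_eq, h1, h2]
  have h6 : I * (2 * (cauchyFactor w (t j) * E) - nevanlinnaFactor .zero w (t j) * E)
      = I * ((2 * cauchyFactor w (t j) - nevanlinnaFactor .zero w (t j)) * E) := by ring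
  rw [h6, Complex.I_mul_im, Complex.re_mul_ofReal, h5]
  have : 0 ≤ w.im := by simpa [hw] using hy.le
  positivity

/-- Sublinear growth excludes the linear term of the integral representation. -/
lemma coeff_eq_zero_of_hasSublinearGrowth {f : (Fin n → ℂ) → ℂ} (hf : HasSublinearGrowth f)
    {a : ℝ} {b : Fin n → ℝ} {μ : Measure (Fin n → ℝ)} (hb : ∀ j, 0 ≤ b j)
    (hμ : GrowthCondition μ) (heq : Set.EqOn f (integralFormula a b μ) (polyCutPlane n)) :
    b = 0 := by
  funext j
  refine le_antisymm ?_ (hb j)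
  have hI : (fun _ => I) ∈ polyUpperHalfPlane n := I_mem_polyUpperHalfPlane
  refine ge_of_tendsto (hf.tendsto_im_div j (polyUpperHalfPlane_subset hI)) ?_
  filter_upwards [eventually_gt_atTop 0] with y hy
  have hz := polyUpperHalfPlane_subset
    (update_mem_polyUpperHalfPlane hI j (w := y * I) (by simpa using hy))
  rw [le_div_iff₀ hy, heq hz, integralFormula]
  set z := Function.update (fun _ => I) j ((y : ℂ) * I)
  have h1 : 0 ≤ (1 / (Real.pi : ℂ) ^ n * ∫ t, kernel z t ∂μ).im := by
    rw [show (1 / (Real.pi : ℂ) ^ n) = ((1 / Real.pi ^ n : ℝ) : ℂ) by push_cast; rfl,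
      Complex.im_ofReal_mul, ← RCLike.im_eq_complex_im, ← integral_im (hμ.integrable_kernel hz)]
    exact mul_nonneg (by positivity)
      (integral_nonneg fun t => kernel_update_I_im_nonneg j hy t)
  have h2 : b j * y ≤ (∑ k, (b k : ℂ) * z k).im := by
    rw [Complex.im_sum]
    have : b j * y = ((b j : ℂ) * z j).im := by simp [z]
    rw [this]
    refine Finset.single_le_sum (f := fun k => ((b k : ℂ) * z k).im) (fun k _ => ?_)
      (Finset.mem_univ j)
    rw [Complex.im_ofReal_mul]
    refine mul_nonneg (hb k) ?_
    rcases eq_or_ne k j with rfl | h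
    · simpa [z] using hy.le
    · simp [z, h]
  rw [Complex.add_im, Complex.add_im, Complex.ofReal_im]
  linarith

/-! ### The symmetry formula -/

lemma sum_nonempty_eq_sub {M : Type*} [AddCommGroup M] (g : Finset (Fin n) → M) :
    ∑ B with B.Nonempty, g B = ∑ B, g B - g ∅ := by
  rw [eq_sub_iff_add_eq, ← Finset.sum_filter_add_sum_filter_not Finset.univ
    (fun B : Finset (Fin n) => B.Nonempty)]
  congr 1
  rw [Finset.sum_eq_single_of_mem ∅ (by simp)]
  intro B hB hne
  exact absurd (Finset.nonempty_iff_ne_empty.mpr hne) (Finset.mem_filter.mp hB).2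

lemma sum_neg_one_pow_card_mul_prod_ite (p q : Fin n → ℂ) :
    ∑ B : Finset (Fin n), (-1) ^ B.card * ∏ j, (if j ∈ B then p j else q j) =
      ∏ j, (q j - p j) := by
  have := Finset.prod_add (fun j => -p j) q Finset.univ
  simp only [Finset.powerset_univ] at this
  rw [show (∏ j, (q j - p j)) = ∏ j, (-p j + q j) by congr! 1; ring, this]
  refine Finset.sum_congr rfl fun B _ => ?_
  rw [Finset.prod_neg, Finset.prod_ite, mul_assoc]
  congr 3
  · ext; simp
  · ext; simp

lemma selectiveConj_I_mem {z : Fin n → ℂ} (hz : z ∈ polyCutPlane n) (B : Finset (Fin n)) :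
    selectiveConj B (fun _ => I) z ∈ polyCutPlane n := by
  intro j
  by_cases h : j ∈ B
  · simpa [selectiveConj, h] using hz j
  · simp [selectiveConj, h]

/-- The kernel satisfies the symmetry formula pointwise. -/
lemma kernel_eq_sum_conj (hn : 1 ≤ n) (z : Fin n → ℂ) (t : Fin n → ℝ) :
    ∑ B : Finset (Fin n) with B.Nonempty,
      (-1 : ℂ) ^ (B.card + 1) * conj (kernel (selectiveConj B (fun _ => I) z) t) = kernel z t := by
  set e : Fin n → ℂ := fun j => nevanlinnaFactor .zero (z j) (t j) with he
  set c : Fin n → ℂ := fun j => cauchyFactor (z j) (t j)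
  have he' : ∀ (w : ℂ) j, nevanlinnaFactor .zero w (t j) = e j := fun _ _ => rfl
  have hec : ∀ j, conj (e j) = e j := fun j => by
    simp only [he]; rw [nevanlinnaFactor_zero_eq, conj_ofReal]
  have hK : ∀ B : Finset (Fin n), conj (kernel (selectiveConj B (fun _ => I) z) t) =
      -I * (2 * ∏ j, (if j ∈ B then e j - c j else e j) - ∏ j, e j) := by
    intro B
    rw [kernel_eq]
    simp only [he', map_mul, map_sub, map_prod, conj_I, hec, map_ofNat]
    congr 3
    refine Finset.prod_congr rfl fun j _ => ?_
    split_ifs with h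
    · simp only [selectiveConj, h, if_true]
      exact conj_cauchyFactor_conj _ _
    · simp only [selectiveConj, h, if_false, cauchyFactor_I]
      exact hec j
  have h1 := sum_neg_one_pow_card_mul_prod_ite (fun j => e j - c j) e
  have h2 := sum_neg_one_pow_card_mul_prod_ite (n := n) (fun _ => 1) (fun _ => 1)
  simp only [sub_sub_cancel] at h1
  simp only [ite_self, Finset.prod_const_one, mul_one, sub_self, Finset.prod_const,
    Finset.card_univ, Fintype.card_fin, zero_pow (by omega : n ≠ 0)] at h2
  simp only [hK]
  have h3 : ∀ B : Finset (Fin n), (-1 : ℂ) ^ (B.card + 1) *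
      (-I * (2 * ∏ j, (if j ∈ B then e j - c j else e j) - ∏ j, e j)) =
      2 * I * ((-1) ^ B.card * ∏ j, (if j ∈ B then e j - c j else e j))
        - I * (∏ j, e j) * (-1) ^ B.card := by
    intro B; ring
  simp only [h3]
  rw [sum_nonempty_eq_sub, Finset.sum_sub_distrib, ← Finset.mul_sum, ← Finset.mul_sum, h1, h2,
    kernel_eq]
  simp only [Finset.card_empty, Finset.notMem_empty, if_false, he']
  ring

lemma symmetryFormula_integralFormula (hn : 1 ≤ n) {f : (Fin n → ℂ) → ℂ}
    {a : ℝ} {μ : Measure (Fin n → ℝ)} (hμ : GrowthCondition μ)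
    (heq : Set.EqOn f (integralFormula a 0 μ) (polyCutPlane n)) : SymmetryFormula f := by
  intro z hz
  have hf : ∀ w ∈ polyCutPlane n, f w = a + 1 / (Real.pi : ℂ) ^ n * ∫ t, kernel w t ∂μ := by
    intro w hw
    rw [heq hw, integralFormula]
    simp
  have hi : ∀ B : Finset (Fin n),
      Integrable (fun t => conj (kernel (selectiveConj B (fun _ => I) z) t)) μ := fun B =>
    (LinearIsometryEquiv.integrable_comp_iff conjLIE).mpr
      (hμ.integrable_kernel (selectiveConj_I_mem hz B))
  have h2 := sum_neg_one_pow_card_mul_prod_ite (n := n) (fun _ => 1) (fun _ => 1)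
  simp only [ite_self, Finset.prod_const_one, mul_one, sub_self, Finset.prod_const,
    Finset.card_univ, Fintype.card_fin, zero_pow (by omega : n ≠ 0)] at h2
  have h3 : ∀ B : Finset (Fin n),
      (-1 : ℂ) ^ (B.card + 1) * conj (f (selectiveConj B (fun _ => I) z)) =
      -a * (-1) ^ B.card + 1 / (Real.pi : ℂ) ^ n *
        ∫ t, (-1 : ℂ) ^ (B.card + 1) * conj (kernel (selectiveConj B (fun _ => I) z) t) ∂μ := by
    intro B
    rw [hf _ (selectiveConj_I_mem hz B), integral_const_mul, integral_conj]
    simp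
    ring
  simp only [h3]
  rw [hf z hz, Finset.sum_add_distrib, ← Finset.mul_sum, ← Finset.mul_sum, sum_nonempty_eq_sub, h2,
    ← integral_finsetSum _ fun B _ => (hi B).const_mul _]
  simp only [kernel_eq_sum_conj hn]
  simp

/-! ### Variable non-dependence -/

/-- The set of signs that occur in the expansion of `cauchyFactor z` into Nevanlinna factors at the
point of `z`, `conj z` that lies in the upper half-plane. -/
noncomputable def expansionSigns (z : ℂ) : Finset SignType :=
  if 0 < z.im then {.neg, .zero} else {.pos}

lemma cauchyFactor_eq_sum (z : ℂ) (t : ℝ) :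
    cauchyFactor z t = (if 0 < z.im then 1 else -1) *
      ∑ s ∈ expansionSigns z, nevanlinnaFactor s (if 0 < z.im then z else conj z) t := by
  by_cases h : 0 < z.im
  · simp only [expansionSigns, h, if_true, one_mul]
    rw [Finset.sum_insert (by decide), Finset.sum_singleton, nevanlinnaFactor_neg_add_zero]
  · simp only [expansionSigns, h, if_false]
    rw [Finset.sum_singleton, neg_one_mul, ← cauchyFactor_conj, conj_conj]

/-- Under the Nevanlinna condition, the product of the functions `cauchyFactor` has an integral
that does not depend on the variables in the upper half-plane, provided that some variable lies in
the lower half-plane. -/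
lemma integral_cauchyFactor_eq {μ : Measure (Fin n → ℝ)} (hμ : GrowthCondition μ)
    (hN : NevanlinnaCondition μ) {z : Fin n → ℂ} (hz : z ∈ polyCutPlane n)
    (hlow : ∃ j, (z j).im < 0) :
    ∫ t, ∏ j, cauchyFactor (z j) (t j) ∂μ =
      (∏ j, if 0 < (z j).im then 1 else -1) *
        nevanlinnaIntegral μ (fun j => if 0 < (z j).im then 0 else 1)
          (fun j => if 0 < (z j).im then z j else conj (z j)) := by
  set Z : Fin n → ℂ := fun j => if 0 < (z j).im then z j else conj (z j)
  have hZ : Z ∈ polyUpperHalfPlane n := by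
    intro j
    by_cases h : 0 < (z j).im
    · simp [Z, h]
    · simpa [Z, h] using lt_of_le_of_ne (not_lt.mp h) (hz j)
  have h1 : ∀ t : Fin n → ℝ, ∏ j, cauchyFactor (z j) (t j) =
      (∏ j, if 0 < (z j).im then 1 else -1) *
        ∑ ρ ∈ Fintype.piFinset fun j => expansionSigns (z j),
          ∏ j, nevanlinnaFactor (ρ j) (Z j) (t j) := by
    intro t
    rw [← Finset.prod_univ_sum (fun j => expansionSigns (z j))
      (fun j s => nevanlinnaFactor s (Z j) (t j)), ← Finset.prod_mul_distrib]
    exact Finset.prod_congr rfl fun j _ => cauchyFactor_eq_sum _ _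
  simp only [h1]
  rw [integral_const_mul, integral_finsetSum _ fun ρ _ =>
    hμ.integrable_nevanlinna ρ (polyUpperHalfPlane_subset hZ)]
  congr 1
  refine Finset.sum_eq_single_of_mem _ ?_ ?_
  · rw [Fintype.mem_piFinset]
    intro j
    by_cases h : 0 < (z j).im
    · simp [expansionSigns, h]
    · simp [expansionSigns, h]
  · intro ρ hρ hne
    rw [Fintype.mem_piFinset] at hρ
    refine nevanlinnaIntegral_eq_zero_of_sum_eq_zero hμ hN (σ := ρ) ?_ hZ
    obtain ⟨j, hj⟩ := hlow
    obtain ⟨k, hk⟩ := Function.ne_iff.mp hne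
    refine Finset.mem_filter.mpr ⟨Finset.mem_univ _, ⟨k, ?_⟩, ⟨j, ?_⟩⟩
    · have := hρ k
      by_cases h : 0 < (z k).im
      · simp only [expansionSigns, h, if_true] at this hk
        rw [Finset.mem_insert, Finset.mem_singleton] at this
        exact this.resolve_right hk
      · simp only [expansionSigns, h, if_false] at this hk
        exact absurd (Finset.mem_singleton.mp this) hk
    · have := hρ j
      simp only [expansionSigns, not_lt.mpr hj.le, if_false] at this
      exact Finset.mem_singleton.mp this

lemma variableNonDependence_integralFormula {f : (Fin n → ℂ) → ℂ}
    {a : ℝ} {μ : Measure (Fin n → ℝ)} (hμ : GrowthCondition μ) (hN : NevanlinnaCondition μ)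
    (heq : Set.EqOn f (integralFormula a 0 μ) (polyCutPlane n)) : VariableNonDependence f := by
  intro z hz w hw hlow hzw
  have hlow' : ∃ j, (w j).im < 0 := by
    obtain ⟨j, hj⟩ := hlow
    refine ⟨j, ?_⟩
    rcases hzw j with h | h
    · rwa [h]
    · exact absurd h.1 hj.le.not_gt
  have hK : ∀ v ∈ polyCutPlane n, ∫ t, kernel v t ∂μ =
      I * (2 * ∫ t, ∏ j, cauchyFactor (v j) (t j) ∂μ
        - ∫ t : Fin n → ℝ, ∏ j, nevanlinnaFactor .zero I (t j) ∂μ) := by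
    intro v hv
    simp only [kernel_eq]
    rw [integral_const_mul, integral_sub ((hμ.integrable_cauchy hv).const_mul 2)
      (hμ.integrable_nevanlinna (fun _ => .zero) hv), integral_const_mul]
    rfl
  have hiff : ∀ j, 0 < (w j).im ↔ 0 < (z j).im := by
    intro j
    rcases hzw j with h | h
    · rw [h]
    · simp [h.1, h.2]
  have hint : nevanlinnaIntegral μ (fun j => if 0 < (z j).im then 0 else 1)
        (fun j => if 0 < (z j).im then w j else conj (w j)) =
      nevanlinnaIntegral μ (fun j => if 0 < (z j).im then 0 else 1)
        (fun j => if 0 < (z j).im then z j else conj (z j)) := by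
    simp only [nevanlinnaIntegral]
    refine integral_congr_ae (ae_of_all _ fun t => Finset.prod_congr rfl fun j _ => ?_)
    by_cases h : 0 < (z j).im
    · simp only [h, if_true]
      rfl
    · rw [(hzw j).resolve_right fun h' => h h'.1]
  rw [heq hw, heq hz, integralFormula, integralFormula, hK w hw, hK z hz,
    integral_cauchyFactor_eq hμ hN hw hlow', integral_cauchyFactor_eq hμ hN hz hlow]
  simp only [hiff, hint]
  simp

/-! ### Uniqueness of the extension to the poly cut-plane -/

/-- A function on the poly cut-plane with the symmetry formula and the variable non-dependence
property is determined by its values on the poly-upper half-plane. -/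
lemma eqOn_polyCutPlane_of_eqOn_polyUpperHalfPlane {f g : (Fin n → ℂ) → ℂ}
    (hf : SymmetryFormula f) (hg : SymmetryFormula g) (hf' : VariableNonDependence f)
    (hg' : VariableNonDependence g) (heq : Set.EqOn f g (polyUpperHalfPlane n)) :
    Set.EqOn f g (polyCutPlane n) := by
  intro z hz
  by_cases hup : z ∈ polyUpperHalfPlane n
  · exact heq hup
  obtain ⟨j₀, hj₀⟩ : ∃ j, (z j).im < 0 := by
    by_contra! h
    exact hup fun j => lt_of_le_of_ne (h j) (hz j).symm
  set ζ : Finset (Fin n) → Fin n → ℂ := fun B => selectiveConj B (fun _ => I) z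
  have hζ : ∀ B, ζ B ∈ polyCutPlane n := selectiveConj_I_mem hz
  set d : (Fin n → ℂ) → ℂ := fun w => f w - g w with hd
  have hd0 : d (ζ ∅) = 0 := by
    have : ζ ∅ ∈ polyUpperHalfPlane n := by intro j; simp [ζ, selectiveConj]
    simp [d, heq this]
  have hsum : d z = ∑ B, (-1 : ℂ) ^ (B.card + 1) * conj (d (ζ B)) := by
    have h1 := sum_nonempty_eq_sub fun B : Finset (Fin n) =>
      (-1 : ℂ) ^ (B.card + 1) * conj (d (ζ B))
    rw [hd0, map_zero, mul_zero, sub_zero] at h1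
    rw [← h1]
    simp only [hd, map_sub, mul_sub, Finset.sum_sub_distrib]
    rw [hf z hz, hg z hz]
  -- toggling the index `j₀` of a lower variable changes the sign of the summand, but not `d (ζ B)`
  have key : ∀ B, j₀ ∉ B → d (ζ (insert j₀ B)) = d (ζ B) := by
    intro B hB
    have hother : ∀ k, ζ (insert j₀ B) k = ζ B k ∨
        (0 < (ζ B k).im ∧ 0 < (ζ (insert j₀ B) k).im) := by
      intro k
      rcases eq_or_ne k j₀ with rfl | h
      · right
        simpa [ζ, selectiveConj, hB] using hj₀
      · left
        simp [ζ, selectiveConj, h]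
    by_cases hlow : ∃ j, (ζ B j).im < 0
    · simp only [hd]
      rw [hf' _ (hζ B) _ (hζ _) hlow hother, hg' _ (hζ B) _ (hζ _) hlow hother]
    · have h1 : ζ B ∈ polyUpperHalfPlane n := by
        push Not at hlow
        exact fun j => lt_of_le_of_ne (hlow j) (hζ B j).symm
      have h2 : ζ (insert j₀ B) ∈ polyUpperHalfPlane n := by
        intro j
        rcases hother j with h | h
        · rw [h]; exact h1 j
        · exact h.2
      simp [hd, heq h1, heq h2]
  have hz0 : d z = 0 := by
    rw [hsum, ← Finset.sum_filter_add_sum_filter_not Finset.univ (fun B : Finset (Fin n) => j₀ ∈ B)]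
    have : ∑ B : Finset (Fin n) with j₀ ∈ B, (-1 : ℂ) ^ (B.card + 1) * conj (d (ζ B)) =
        ∑ B : Finset (Fin n) with j₀ ∉ B,
          -((-1 : ℂ) ^ (B.card + 1) * conj (d (ζ B))) := by
      refine (Finset.sum_bij' (fun B _ => insert j₀ B) (fun B _ => B.erase j₀) ?_ ?_ ?_ ?_ ?_).symm
      · intro B _; simp
      · intro B _; simp
      · intro B hB; exact Finset.erase_insert (Finset.mem_filter.mp hB).2
      · intro B hB; exact Finset.insert_erase (Finset.mem_filter.mp hB).2
      · intro B hB
        have := (Finset.mem_filter.mp hB).2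
        rw [key B this, Finset.card_insert_of_notMem this]
        ring
    rw [this, ← Finset.sum_add_distrib]
    simp
  exact sub_eq_zero.mp hz0

/-! ### The Poisson integral on the polydisc -/

noncomputable instance : MeasurableSpace Circle := borel Circle

instance : BorelSpace Circle := ⟨rfl⟩

/-- The normalised arc length measure on the unit circle. -/
noncomputable def arcMeasure : Measure Circle :=
  ENNReal.ofReal (2 * Real.pi)⁻¹ •
    ((volume : Measure ℝ).restrict (Set.Ioc 0 (2 * Real.pi))).map Circle.exp

instance : IsFiniteMeasure arcMeasure := by
  unfold arcMeasure
  exact Measure.smul_finite _ ENNReal.ofReal_ne_top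

lemma continuous_poissonKernel_circle {w : ℂ} (hw : w ∈ Metric.ball (0 : ℂ) 1) :
    Continuous fun ω : Circle => poissonKernel 0 w ω := by
  simp only [poissonKernel, sub_zero]
  refine Continuous.div (by fun_prop) (by fun_prop) fun ω => ?_
  have h1 : ‖w‖ < 1 := by simpa using hw
  have h2 : ‖(ω : ℂ)‖ = 1 := Circle.norm_coe ω
  have : (ω : ℂ) - w ≠ 0 := by
    intro h
    rw [sub_eq_zero.mp h] at h2
    linarith
  have := norm_pos_iff.mpr this
  positivity

lemma poissonKernel_circle_nonneg {w : ℂ} (hw : w ∈ Metric.ball (0 : ℂ) 1) (ω : Circle) :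
    0 ≤ poissonKernel 0 w ω := by
  have h1 : ‖w‖ < 1 := by simpa using hw
  simp only [poissonKernel, sub_zero, Circle.norm_coe]
  have : 0 ≤ 1 ^ 2 - ‖w‖ ^ 2 := by nlinarith [norm_nonneg w]
  positivity

/-- The Poisson integral formula for the imaginary part of a holomorphic function, as a Lebesgue
integral over the unit circle. -/
lemma lintegral_poissonKernel_mul_im {g : ℂ → ℂ} (hg : DiffContOnCl ℂ g (Metric.ball 0 1))
    (hpos : ∀ ω : Circle, 0 ≤ (g ω).im) {w : ℂ} (hw : w ∈ Metric.ball (0 : ℂ) 1) :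
    ∫⁻ ω : Circle, ENNReal.ofReal (poissonKernel 0 w ω) * ENNReal.ofReal (g ω).im ∂arcMeasure =
      ENNReal.ofReal (g w).im := by
  have hgc : Continuous fun ω : Circle => g ω := by
    refine hg.continuousOn.comp_continuous continuous_subtype_val fun ω => ?_
    rw [closure_ball _ one_ne_zero]
    simp [Circle.norm_coe]
  have hP := continuous_poissonKernel_circle hw
  have hcont : Continuous fun ω : Circle => poissonKernel 0 w ω * (g ω).im :=
    hP.mul (Complex.continuous_im.comp hgc)
  have hmap : ∀ θ : ℝ, circleMap 0 1 θ = (Circle.exp θ : ℂ) := by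
    intro θ; simp [circleMap]
  have h1 := hg.circleAverage_poissonKernel_smul hw
  have hci : CircleIntegrable (poissonKernel 0 w • g) 0 1 := by
    refine Continuous.intervalIntegrable ?_ _ _
    simp only [Pi.smul_apply', hmap]
    exact (hP.comp Circle.exp.continuous).smul (hgc.comp Circle.exp.continuous)
  have h2 : (g w).im = (2 * Real.pi)⁻¹ *
      ∫ θ in Set.Ioc 0 (2 * Real.pi), poissonKernel 0 w (Circle.exp θ) * (g (Circle.exp θ)).im := by
    rw [← h1, ← Complex.imCLM_apply, ← Complex.imCLM.circleAverage_comp_comm hci,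
      Real.circleAverage_def, intervalIntegral.integral_of_le (by positivity), smul_eq_mul]
    simp [hmap]
  rw [h2, arcMeasure, lintegral_smul_measure, smul_eq_mul,
    ENNReal.ofReal_mul (by positivity)]
  congr 1
  have h3 : ∀ ω : Circle, ENNReal.ofReal (poissonKernel 0 w ω) * ENNReal.ofReal (g ω).im =
      ENNReal.ofReal (poissonKernel 0 w ω * (g ω).im) := fun ω =>
    (ENNReal.ofReal_mul (poissonKernel_circle_nonneg hw ω)).symm
  simp only [h3]
  rw [lintegral_map hcont.measurable.ennreal_ofReal Circle.exp.continuous.measurable,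
    ofReal_integral_eq_lintegral_ofReal]
  · refine (Continuous.integrableOn_Icc ?_).mono_set Set.Ioc_subset_Icc_self
    exact hcont.comp Circle.exp.continuous
  · exact ae_of_all _ fun θ => mul_nonneg (poissonKernel_circle_nonneg hw _) (hpos _)

/-- The Poisson integral formula on the closed polydisc, obtained by applying the formula for the
disc to one variable after the other. -/
lemma lintegral_prod_poissonKernel_mul_im {G : (Fin n → ℂ) → ℂ}
    (hc : ContinuousOn G (Metric.closedBall 0 1))
    (hd : ∀ v ∈ Metric.closedBall (0 : Fin n → ℂ) 1, ∀ j,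
      DiffContOnCl ℂ (fun ζ => G (Function.update v j ζ)) (Metric.ball 0 1))
    (hpos : ∀ v ∈ Metric.closedBall (0 : Fin n → ℂ) 1, 0 ≤ (G v).im)
    {w : Fin n → ℂ} (hw : w ∈ Metric.ball (0 : Fin n → ℂ) 1) :
    ∫⁻ ω : Fin n → Circle, (∏ l, ENNReal.ofReal (poissonKernel 0 (w l) (ω l))) *
      ENNReal.ofReal (G fun l => ω l).im ∂(Measure.pi fun _ => arcMeasure) =
      ENNReal.ofReal (G w).im := by
  have hwl : ∀ l, w l ∈ Metric.ball (0 : ℂ) 1 := fun l => by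
    rw [mem_ball_zero_iff] at hw ⊢
    exact (norm_le_pi_norm w l).trans_lt hw
  set v : Finset (Fin n) → (Fin n → Circle) → Fin n → ℂ :=
    fun s x l => if l ∈ s then (x l : ℂ) else w l
  have hvmem : ∀ s x, v s x ∈ Metric.closedBall (0 : Fin n → ℂ) 1 := by
    intro s x
    rw [mem_closedBall_zero_iff, pi_norm_le_iff_of_nonneg zero_le_one]
    intro l
    by_cases h : l ∈ s
    · simp [v, h, Circle.norm_coe]
    · simpa [v, h] using (mem_ball_zero_iff.mp (hwl l)).le
  set H : Finset (Fin n) → (Fin n → Circle) → ENNReal := fun s x =>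
    (∏ l ∈ s, ENNReal.ofReal (poissonKernel 0 (w l) (x l))) * ENNReal.ofReal (G (v s x)).im with hH
  have hHm : ∀ s, Measurable (H s) := by
    intro s
    refine Measurable.mul ?_ ?_
    · exact Finset.measurable_prod _ fun l _ =>
        ((continuous_poissonKernel_circle (hwl l)).measurable.comp
          (measurable_pi_apply l)).ennreal_ofReal
    · refine Measurable.ennreal_ofReal (Continuous.measurable ?_)
      refine Complex.continuous_im.comp (hc.comp_continuous ?_ (hvmem s))
      refine continuous_pi fun l => ?_
      by_cases h : l ∈ s
      · simp only [v, h, if_true]; fun_prop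
      · simp only [v, h, if_false]; fun_prop
  have claim : ∀ s : Finset (Fin n), ∀ x,
      lmarginal (fun _ => arcMeasure) s (H s) x = ENNReal.ofReal (G w).im := by
    intro s
    induction s using Finset.induction_on with
    | empty => intro x; simp [H, v]
    | insert i s hi ih =>
      intro x
      rw [lmarginal_insert' _ (hHm _) hi, ← ih x]
      congr 1
      funext y
      have hvu : ∀ ξ : Circle, v (insert i s) (Function.update y i ξ) =
          Function.update (v s y) i (ξ : ℂ) := by
        intro ξ
        funext l
        rcases eq_or_ne l i with rfl | h
        · simp [v]
        · simp [v, h]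
      have hvi : Function.update (v s y) i (w i) = v s y := by
        rw [Function.update_eq_self_iff]
        simp [v, hi]
      have hHu : ∀ ξ : Circle, H (insert i s) (Function.update y i ξ) =
          (∏ l ∈ s, ENNReal.ofReal (poissonKernel 0 (w l) (y l))) *
          (ENNReal.ofReal (poissonKernel 0 (w i) ξ) *
            ENNReal.ofReal (G (Function.update (v s y) i (ξ : ℂ))).im) := by
        intro ξ
        simp only [hH]
        rw [Finset.prod_insert hi, Function.update_self, hvu]
        have : ∏ l ∈ s, ENNReal.ofReal (poissonKernel 0 (w l) (Function.update y i ξ l)) =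
            ∏ l ∈ s, ENNReal.ofReal (poissonKernel 0 (w l) (y l)) := by
          refine Finset.prod_congr rfl fun l hl => ?_
          rw [Function.update_of_ne (by rintro rfl; exact hi hl)]
        rw [this]
        ring
      have h1 := lintegral_poissonKernel_mul_im (hd _ (hvmem s y) i)
        (fun ω => by rw [← hvu]; exact hpos _ (hvmem _ _)) (hwl i)
      rw [hvi] at h1
      simp only [hHu]
      rw [lintegral_const_mul', h1]
      exact ENNReal.prod_ne_top fun _ _ => ENNReal.ofReal_ne_top
  have := claim Finset.univ (fun _ => 1)
  rw [lmarginal_univ] at this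
  simpa [H, v] using this

/-- The imaginary part of a holomorphic function on the polydisc is the Poisson integral of a finite
measure on the torus if it is non-negative. The measure is a weak limit of the measures with density
`Im G(r ω)` as `r → 1`. -/
theorem exists_finiteMeasure_integral_prod_poissonKernel {G : (Fin n → ℂ) → ℂ}
    (hG : DifferentiableOn ℂ G (Metric.ball 0 1))
    (hpos : ∀ w ∈ Metric.ball (0 : Fin n → ℂ) 1, 0 ≤ (G w).im) :
    ∃ ν : FiniteMeasure (Fin n → Circle), ∀ w ∈ Metric.ball (0 : Fin n → ℂ) 1,
      (G w).im = ∫ ω : Fin n → Circle, ∏ l, poissonKernel 0 (w l) (ω l) ∂(ν : Measure _) := by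
  set r : ℕ → ℝ := fun k => 1 - 1 / ((k : ℝ) + 2)
  have hr0 : ∀ k, 0 < r k := by
    intro k
    simp only [r, sub_pos]
    rw [div_lt_one (by positivity)]
    linarith [(Nat.cast_nonneg k : (0 : ℝ) ≤ k)]
  have hr1 : ∀ k, r k < 1 := fun k => by
    simp only [r]; linarith [show 0 < 1 / ((k : ℝ) + 2) by positivity]
  have hrlim : Tendsto r atTop (𝓝 1) := by
    have h1 : Tendsto (fun k : ℕ => 1 / ((k : ℝ) + 2)) atTop (𝓝 0) := by
      have := tendsto_atTop_add_const_right atTop (2 : ℝ) (tendsto_natCast_atTop_atTop (R := ℝ))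
      exact this.inv_tendsto_atTop.congr fun k => (one_div _).symm
    simpa [r] using tendsto_const_nhds.sub h1
  have hmaps : ∀ k, ∀ v ∈ Metric.closedBall (0 : Fin n → ℂ) 1, r k • v ∈ Metric.ball 0 1 := by
    intro k v hv
    rw [mem_closedBall_zero_iff] at hv
    rw [mem_ball_zero_iff, norm_smul, Real.norm_of_nonneg (hr0 k).le]
    nlinarith [hr0 k, hr1 k, norm_nonneg v]
  -- the dilation is defined on a neighbourhood of the closed polydisc
  have hdil : ∀ k, ∀ v ∈ Metric.closedBall (0 : Fin n → ℂ) 1,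
      DifferentiableAt ℂ (fun v => G (r k • v)) v := by
    intro k v hv
    have h1 := hG.differentiableAt (Metric.isOpen_ball.mem_nhds (hmaps k v hv))
    exact h1.comp v (differentiableAt_id.const_smul (r k))
  have hpoisson : ∀ k, ∀ w ∈ Metric.ball (0 : Fin n → ℂ) 1,
      ∫⁻ ω : Fin n → Circle, (∏ l, ENNReal.ofReal (poissonKernel 0 (w l) (ω l))) *
        ENNReal.ofReal (G (r k • fun l => (ω l : ℂ))).im ∂(Measure.pi fun _ => arcMeasure) =
        ENNReal.ofReal (G (r k • w)).im := by
    intro k w hw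
    refine lintegral_prod_poissonKernel_mul_im (G := fun v => G (r k • v))
      (fun v hv => (hdil k v hv).continuousAt.continuousWithinAt) (fun v hv j => ?_)
      (fun v hv => hpos _ (hmaps k v hv)) hw
    refine DifferentiableOn.diffContOnCl fun ζ hζ => ?_
    rw [closure_ball _ one_ne_zero] at hζ
    have hmem : Function.update v j ζ ∈ Metric.closedBall (0 : Fin n → ℂ) 1 := by
      rw [mem_closedBall_zero_iff, pi_norm_le_iff_of_nonneg zero_le_one] at hv ⊢
      intro l
      rcases eq_or_ne l j with rfl | h
      · simpa using hζ
      · simpa [h] using hv l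
    exact ((hdil k _ hmem).comp ζ
      (hasFDerivAt_update v ζ).differentiableAt).differentiableWithinAt
  set den : ℕ → (Fin n → Circle) → ENNReal := fun k ω =>
    ENNReal.ofReal (G (r k • fun l => (ω l : ℂ))).im
  have hcirc : ∀ ω : Fin n → Circle,
      (fun l => (ω l : ℂ)) ∈ Metric.closedBall (0 : Fin n → ℂ) 1 := by
    intro ω
    rw [mem_closedBall_zero_iff, pi_norm_le_iff_of_nonneg zero_le_one]
    exact fun l => (Circle.norm_coe (ω l)).le
  have hdenm : ∀ k, Measurable (den k) := by
    intro k
    refine Measurable.ennreal_ofReal (Continuous.measurable ?_)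
    refine Complex.continuous_im.comp ?_
    have : ContinuousOn (fun v => G (r k • v)) (Metric.closedBall 0 1) :=
      fun v hv => (hdil k v hv).continuousAt.continuousWithinAt
    exact this.comp_continuous (by fun_prop) hcirc
  have hmass : ∀ k, ((Measure.pi fun _ : Fin n => arcMeasure).withDensity (den k)) Set.univ =
      ENNReal.ofReal (G 0).im := by
    intro k
    have := hpoisson k 0 (by simp)
    rw [withDensity_apply _ MeasurableSet.univ, Measure.restrict_univ]
    simpa [poissonKernel] using this
  let ν : ℕ → FiniteMeasure (Fin n → Circle) := fun k =>
    ⟨(Measure.pi fun _ : Fin n => arcMeasure).withDensity (den k),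
      ⟨by rw [hmass k]; exact ENNReal.ofReal_lt_top⟩⟩
  have hνmass : ∀ k, (ν k).mass ≤ (G 0).im.toNNReal := by
    intro k
    have : ((ν k).mass : ENNReal) ≤ ((G 0).im.toNNReal : ENNReal) := by
      rw [FiniteMeasure.ennreal_mass]
      exact (hmass k).le
    exact_mod_cast this
  obtain ⟨ν₀, _, hν₀⟩ := isCompact_iff_ultrafilter_le_nhds'.mp
    (isCompact_setOfPred_finiteMeasure_le_of_compactSpace (Fin n → Circle) (G 0).im.toNNReal)
    ((hyperfilter ℕ).map ν) (mem_map.mpr (Eventually.of_forall hνmass))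
  have hlim : Tendsto ν (hyperfilter ℕ) (𝓝 ν₀) := hν₀
  refine ⟨ν₀, fun w hw => ?_⟩
  have hwl : ∀ l, w l ∈ Metric.ball (0 : ℂ) 1 := fun l => by
    rw [mem_ball_zero_iff] at hw ⊢
    exact (norm_le_pi_norm w l).trans_lt hw
  have hPc : Continuous fun ω : Fin n → Circle => ∏ l, poissonKernel 0 (w l) (ω l) :=
    continuous_finsetProd _ fun l _ =>
      (continuous_poissonKernel_circle (hwl l)).comp (continuous_apply l)
  have hP0 : ∀ ω : Fin n → Circle, 0 ≤ ∏ l, poissonKernel 0 (w l) (ω l) := fun ω =>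
    Finset.prod_nonneg fun l _ => poissonKernel_circle_nonneg (hwl l) _
  have hval : ∀ k, ∫ ω, ∏ l, poissonKernel 0 (w l) (ω l) ∂(ν k : Measure (Fin n → Circle)) =
      (G (r k • w)).im := by
    intro k
    rw [integral_eq_lintegral_of_nonneg_ae (ae_of_all _ hP0)
      hPc.measurable.aestronglyMeasurable]
    change (∫⁻ ω, _ ∂(Measure.pi fun _ : Fin n => arcMeasure).withDensity (den k)).toReal = _
    rw [lintegral_withDensity_eq_lintegral_mul _ (hdenm k) hPc.measurable.ennreal_ofReal]
    have h1 := hpoisson k w hw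
    rw [← ENNReal.toReal_ofReal (hpos _ (hmaps k w (Metric.ball_subset_closedBall hw))), ← h1]
    congr 1
    refine lintegral_congr fun ω => ?_
    rw [Pi.mul_apply, mul_comm, ENNReal.ofReal_prod_of_nonneg fun l _ =>
      poissonKernel_circle_nonneg (hwl l) _]
  have h1 := (FiniteMeasure.tendsto_iff_forall_integral_tendsto.mp hlim)
    (BoundedContinuousFunction.mkOfCompact ⟨_, hPc⟩)
  simp only [BoundedContinuousFunction.mkOfCompact_apply, ContinuousMap.coe_mk, hval] at h1
  have h2 : Tendsto (fun k => (G (r k • w)).im) atTop (𝓝 (G w).im) := by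
    have h3 : ContinuousAt G w :=
      (hG.differentiableAt (Metric.isOpen_ball.mem_nhds hw)).continuousAt
    have h4 : Tendsto (fun k => r k • w) atTop (𝓝 w) := by
      simpa using hrlim.smul_const w
    exact (Complex.continuous_im.tendsto _).comp (h3.tendsto.comp h4)
  exact tendsto_nhds_unique (h2.mono_left Nat.hyperfilter_le_atTop) h1

/-! ### The Poisson integral on the poly-upper half-plane -/

lemma add_I_ne_zero {z : ℂ} (hz : 0 < z.im) : z + I ≠ 0 := by
  intro h
  have := congrArg Complex.im h
  simp at this
  linarith

lemma norm_add_I_sq_sub (z : ℂ) : ‖z + I‖ ^ 2 - ‖z - I‖ ^ 2 = 4 * z.im := by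
  rw [← Complex.normSq_eq_norm_sq, ← Complex.normSq_eq_norm_sq, Complex.normSq_apply,
    Complex.normSq_apply]
  simp
  ring

lemma norm_cayley_lt_one {z : ℂ} (hz : 0 < z.im) : ‖(z - I) / (z + I)‖ < 1 := by
  have h := norm_pos_iff.mpr (add_I_ne_zero hz)
  rw [norm_div, div_lt_one h]
  have := norm_add_I_sq_sub z
  nlinarith [norm_nonneg (z - I)]

lemma one_sub_ne_zero_of_norm_lt_one {w : ℂ} (hw : ‖w‖ < 1) : 1 - w ≠ 0 := by
  intro h
  rw [← sub_eq_zero.mp h] at hw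
  simp at hw

lemma inverse_cayley_im_pos {w : ℂ} (hw : ‖w‖ < 1) : 0 < (I * (1 + w) / (1 - w)).im := by
  have h1 := norm_pos_iff.mpr (one_sub_ne_zero_of_norm_lt_one hw)
  have h2 : (I * (1 + w) / (1 - w)).im = (1 - ‖w‖ ^ 2) / ‖1 - w‖ ^ 2 := by
    rw [Complex.div_im, ← Complex.normSq_eq_norm_sq, ← Complex.normSq_eq_norm_sq,
      Complex.normSq_apply w]
    simp
    ring
  rw [h2]
  have : 0 < 1 - ‖w‖ ^ 2 := by nlinarith [norm_nonneg w]
  positivity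

lemma inverse_cayley_cayley {z : ℂ} (hz : 0 < z.im) :
    I * (1 + (z - I) / (z + I)) / (1 - (z - I) / (z + I)) = z := by
  have h := add_I_ne_zero hz
  have h2 : 1 - (z - I) / (z + I) ≠ 0 := one_sub_ne_zero_of_norm_lt_one (norm_cayley_lt_one hz)
  rw [div_eq_iff h2]
  field_simp
  ring

/-- The point of the real line that corresponds to a point of the circle under the Cayley transform.
Its value at `1`, which corresponds to infinity, is a junk value. -/
noncomputable def circleToReal (ω : Circle) : ℝ := (I * (1 + ω) / (1 - ω)).re

lemma measurable_circleToReal : Measurable circleToReal := by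
  unfold circleToReal
  have hc : Continuous fun ω : Circle => (ω : ℂ) := by fun_prop
  have := hc.measurable
  fun_prop

lemma coe_eq_cayley_circleToReal {ω : Circle} (hω : ω ≠ 1) :
    (ω : ℂ) = ((circleToReal ω : ℂ) - I) / (circleToReal ω + I) := by
  have h1 : 1 - (ω : ℂ) ≠ 0 := by
    intro h
    exact hω (Circle.coe_eq_one.mp (sub_eq_zero.mp h).symm)
  have h0 : (ω : ℂ) ≠ 0 := Circle.coe_ne_zero ω
  have h2 : (ω : ℂ) - 1 ≠ 0 := by rw [← neg_ne_zero]; simpa using h1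
  have hreal : (circleToReal ω : ℂ) = I * (1 + ω) / (1 - ω) := by
    rw [circleToReal, ← Complex.conj_eq_iff_re]
    simp only [map_div₀, map_mul, map_add, map_sub, map_one, conj_I, ← Circle.coe_inv_eq_conj,
      Circle.coe_inv]
    have h3 : 1 - (ω : ℂ)⁻¹ ≠ 0 := by
      intro h
      apply h2
      field_simp at h
      simpa using h
    field_simp
    ring
  rw [eq_div_iff (ofReal_add_I_ne_zero _), hreal]
  field_simp
  ring

/-- The Cayley transform turns the Poisson kernel of the disc into that of the half-plane. -/
lemma poissonKernel_cayley {z : ℂ} (hz : 0 < z.im) {ω : Circle} (hω : ω ≠ 1) :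
    poissonKernel 0 ((z - I) / (z + I)) ω =
      (1 + circleToReal ω ^ 2) * (z.im / ‖(circleToReal ω : ℂ) - z‖ ^ 2) := by
  set t := circleToReal ω
  have h1 := add_I_ne_zero hz
  have h2 := ofReal_add_I_ne_zero t
  have h3 := ofReal_sub_ne_zero hz.ne' t
  have e1 : (ω : ℂ) - (z - I) / (z + I) = 2 * I * (t - z) / ((t + I) * (z + I)) := by
    rw [coe_eq_cayley_circleToReal hω]
    change ((t : ℂ) - I) / (t + I) - _ = _
    field_simp
    ring
  have e2 : ‖(t : ℂ) + I‖ ^ 2 = 1 + t ^ 2 := by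
    rw [← Complex.normSq_eq_norm_sq, Complex.normSq_apply]
    simp
    ring
  have e3 := norm_add_I_sq_sub z
  have p1 := norm_pos_iff.mpr h1
  have p2 := norm_pos_iff.mpr h2
  have p3 := norm_pos_iff.mpr h3
  simp only [poissonKernel, sub_zero, Circle.norm_coe]
  rw [e1, ← e2]
  simp only [norm_div, norm_mul, Complex.norm_I, Complex.norm_ofNat]
  rw [show z.im = (‖z + I‖ ^ 2 - ‖z - I‖ ^ 2) / 4 by rw [e3]; ring]
  field_simp
  ring

lemma poissonKernel_cayley_one {z : ℂ} (hz : 0 < z.im) :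
    poissonKernel 0 ((z - I) / (z + I)) (1 : Circle) = z.im := by
  have h1 := add_I_ne_zero hz
  have e1 : (1 : ℂ) - (z - I) / (z + I) = 2 * I / (z + I) := by
    field_simp
    ring
  have e3 := norm_add_I_sq_sub z
  have p1 := norm_pos_iff.mpr h1
  simp only [poissonKernel, sub_zero, Circle.coe_one, norm_one]
  rw [e1]
  simp only [norm_div, norm_mul, Complex.norm_I, Complex.norm_ofNat]
  rw [show z.im = (‖z + I‖ ^ 2 - ‖z - I‖ ^ 2) / 4 by rw [e3]; ring]
  field_simp
  ring

lemma continuous_prod_poissonKernel {w : Fin n → ℂ} (hw : ∀ l, ‖w l‖ < 1) :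
    Continuous fun ω : Fin n → Circle => ∏ l, poissonKernel 0 (w l) (ω l) :=
  continuous_finsetProd _ fun l _ =>
    (continuous_poissonKernel_circle (by simpa using hw l)).comp (continuous_apply l)

/-- The Poisson representation on the poly-upper half-plane. Sublinear growth of `Im f` along the
imaginary axes makes the measure on the torus vanish at infinity, so that it lives on `ℝⁿ`. -/
theorem exists_measure_im_eq_integral_poisson {f : (Fin n → ℂ) → ℂ}
    (hf : DifferentiableOn ℂ f (polyUpperHalfPlane n))
    (hpos : ∀ z ∈ polyUpperHalfPlane n, 0 ≤ (f z).im)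
    (hgrowth : ∀ j, Tendsto (fun y : ℝ => (f (Function.update (fun _ => I) j (y * I))).im / y)
      atTop (𝓝 0)) :
    ∃ μ : Measure (Fin n → ℝ), GrowthCondition μ ∧ ∀ z ∈ polyUpperHalfPlane n,
      (f z).im = 1 / Real.pi ^ n * ∫ t : Fin n → ℝ, ∏ l, (z l).im / ‖(t l : ℂ) - z l‖ ^ 2 ∂μ := by
  have hballmem : ∀ {w : Fin n → ℂ}, w ∈ Metric.ball (0 : Fin n → ℂ) 1 → ∀ l, ‖w l‖ < 1 := by
    intro w hw l
    exact (norm_le_pi_norm w l).trans_lt (mem_ball_zero_iff.mp hw)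
  have hmaps : Set.MapsTo (fun (w : Fin n → ℂ) l => I * (1 + w l) / (1 - w l))
      (Metric.ball 0 1) (polyUpperHalfPlane n) :=
    fun w hw l => inverse_cayley_im_pos (hballmem hw l)
  obtain ⟨ν, hν⟩ := exists_finiteMeasure_integral_prod_poissonKernel
    (G := fun w => f fun l => I * (1 + w l) / (1 - w l)) (by
      refine hf.comp (fun w hw => ?_) hmaps
      refine DifferentiableAt.differentiableWithinAt ?_
      rw [differentiableAt_pi]
      intro l
      have := one_sub_ne_zero_of_norm_lt_one (hballmem hw l)
      fun_prop (disch := assumption)) (fun w hw => hpos _ (hmaps hw))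
  have hrep : ∀ z ∈ polyUpperHalfPlane n, (f z).im = ∫ ω : Fin n → Circle,
      ∏ l, poissonKernel 0 ((z l - I) / (z l + I)) (ω l) ∂(ν : Measure (Fin n → Circle)) := by
    intro z hz
    rw [← hν fun l => (z l - I) / (z l + I)]
    · congr 2
      funext l
      exact (inverse_cayley_cayley (hz l)).symm
    · rw [mem_ball_zero_iff, pi_norm_lt_iff one_pos]
      exact fun l => norm_cayley_lt_one (hz l)
  have hPint : ∀ z ∈ polyUpperHalfPlane n, Integrable (fun ω : Fin n → Circle =>
      ∏ l, poissonKernel 0 ((z l - I) / (z l + I)) (ω l)) (ν : Measure (Fin n → Circle)) := by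
    intro z hz
    exact (continuous_prod_poissonKernel fun l => norm_cayley_lt_one (hz l))
      |>.integrable_of_hasCompactSupport (HasCompactSupport.of_compactSpace _)
  have hPnonneg : ∀ z ∈ polyUpperHalfPlane n, ∀ ω : Fin n → Circle,
      0 ≤ ∏ l, poissonKernel 0 ((z l - I) / (z l + I)) (ω l) := fun z hz ω =>
    Finset.prod_nonneg fun l _ =>
      poissonKernel_circle_nonneg (by simpa using norm_cayley_lt_one (hz l)) _
  -- the measure of the set `ω_j = 1` is at most `Im f(i, …, iy, …, i) / y`
  have hnull : ∀ j, (ν : Measure (Fin n → Circle)) {ω | ω j = 1} = 0 := by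
    intro j
    have hms : MeasurableSet {ω : Fin n → Circle | ω j = 1} :=
      (measurable_pi_apply j) (measurableSet_singleton 1)
    have hle : ∀ᶠ y : ℝ in atTop, (ν : Measure (Fin n → Circle)).real {ω | ω j = 1} ≤
        (f (Function.update (fun _ => I) j (y * I))).im / y := by
      filter_upwards [eventually_gt_atTop 0] with y hy
      have hz := update_mem_polyUpperHalfPlane I_mem_polyUpperHalfPlane j (n := n)
        (w := y * I) (by simpa using hy)
      rw [le_div_iff₀ hy, hrep _ hz]
      have h1 : (ν : Measure (Fin n → Circle)).real {ω | ω j = 1} * y =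
          ∫ ω, Set.indicator {ω : Fin n → Circle | ω j = 1} (fun _ => y) ω
            ∂(ν : Measure (Fin n → Circle)) := by
        rw [integral_indicator_const _ hms, smul_eq_mul]
      rw [h1]
      refine integral_mono ((integrable_const y).indicator hms) (hPint _ hz) fun ω => ?_
      by_cases hω : ω j = 1
      · rw [Set.indicator_of_mem (by exact hω)]
        refine le_of_eq ?_
        rw [← Finset.mul_prod_erase _ _ (Finset.mem_univ j), hω, Finset.prod_eq_one, mul_one,
          poissonKernel_cayley_one (hz j)]
        · simp
        · intro l hl
          rw [Function.update_of_ne (Finset.ne_of_mem_erase hl)]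
          simp [poissonKernel, Circle.norm_coe]
      · rw [Set.indicator_of_notMem (by exact hω)]
        exact hPnonneg _ hz ω
    have h0 := ge_of_tendsto (hgrowth j) hle
    exact (measureReal_eq_zero_iff).mp (le_antisymm h0 measureReal_nonneg)
  have hae : ∀ᵐ ω ∂(ν : Measure (Fin n → Circle)), ∀ j, ω j ≠ 1 := by
    rw [ae_all_iff]
    intro j
    rw [ae_iff]
    simpa using hnull j
  set c : (Fin n → Circle) → Fin n → ℝ := fun ω l => circleToReal (ω l)
  have hcm : Measurable c := measurable_pi_lambda _ fun l =>
    measurable_circleToReal.comp (measurable_pi_apply l)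
  set q : (Fin n → ℝ) → NNReal := fun t => (Real.pi ^ n * ∏ l, (1 + t l ^ 2)).toNNReal with hq
  have hqm : Measurable q := by fun_prop
  have hq0 : ∀ t : Fin n → ℝ, 0 ≤ Real.pi ^ n * ∏ l, (1 + t l ^ 2) := fun t =>
    mul_nonneg (by positivity) (Finset.prod_nonneg fun l _ => by positivity)
  refine ⟨((ν : Measure (Fin n → Circle)).map c).withDensity fun t => q t, ?_, fun z hz => ?_⟩
  · have hwm : Measurable fun t : Fin n → ℝ => ENNReal.ofReal (∏ l, 1 / (1 + (t l) ^ 2)) := by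
      fun_prop
    rw [GrowthCondition, lintegral_withDensity_eq_lintegral_mul _ hqm.coe_nnreal_ennreal hwm]
    have : ∀ t : Fin n → ℝ, ((fun t => (q t : ENNReal)) *
        fun t : Fin n → ℝ => ENNReal.ofReal (∏ l, 1 / (1 + (t l) ^ 2))) t =
        ENNReal.ofReal (Real.pi ^ n) := by
      intro t
      rw [Pi.mul_apply]
      change ENNReal.ofReal _ * _ = _
      rw [← ENNReal.ofReal_mul (hq0 t), mul_assoc, ← Finset.prod_mul_distrib,
        Finset.prod_eq_one, mul_one]
      intro l _
      have : 1 + t l ^ 2 ≠ 0 := by positivity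
      field_simp
    simp only [this]
    rw [lintegral_const]
    exact ENNReal.mul_lt_top ENNReal.ofReal_lt_top (measure_lt_top _ _)
  · rw [integral_withDensity_eq_integral_smul hqm, hrep z hz, integral_map hcm.aemeasurable]
    · rw [← integral_const_mul]
      refine integral_congr_ae ?_
      filter_upwards [hae] with ω hω
      rw [NNReal.smul_def, smul_eq_mul, hq]
      simp only [Real.coe_toNNReal _ (hq0 _)]
      rw [Finset.prod_congr rfl fun l _ => poissonKernel_cayley (hz l) (hω l),
        Finset.prod_mul_distrib]
      have : (Real.pi ^ n) ≠ 0 := by positivity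
      field_simp
      rfl
    · refine Measurable.aestronglyMeasurable ?_
      fun_prop

/-! ### Existence of the integral representation -/

/-- The index set of the Nevanlinna condition. -/
def mixedSigns (n : ℕ) : Finset (Fin n → SignType) :=
  Finset.univ.filter fun ρ => (∃ j, ρ j = -1) ∧ (∃ j, ρ j = 1)

lemma isOpen_polyUpperHalfPlane : IsOpen (polyUpperHalfPlane n) := by
  have : polyUpperHalfPlane n = ⋂ j, {z : Fin n → ℂ | 0 < (z j).im} := by
    ext; simp [polyUpperHalfPlane]
  rw [this]
  exact isOpen_iInter_of_finite fun j => isOpen_lt continuous_const (by fun_prop)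

lemma integral_kernel_eq {μ : Measure (Fin n → ℝ)} (hμ : GrowthCondition μ) {z : Fin n → ℂ}
    (hz : z ∈ polyUpperHalfPlane n) :
    ∫ t, kernel z t ∂μ = I * (2 * ∑ ρ with ∀ k, ρ k ≠ 1, nevanlinnaIntegral μ ρ z
      - nevanlinnaIntegral μ 0 z) := by
  have hz' := polyUpperHalfPlane_subset hz
  have h1 : ∀ t : Fin n → ℝ, ∏ j, cauchyFactor (z j) (t j) =
      ∑ ρ : Fin n → SignType with ∀ k, ρ k ≠ 1, ∏ j, nevanlinnaFactor (ρ j) (z j) (t j) := by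
    intro t
    have h2 : ∀ j, cauchyFactor (z j) (t j) =
        ∑ s ∈ Finset.univ.filter (fun s : SignType => s ≠ 1), nevanlinnaFactor s (z j) (t j) := by
      intro j
      rw [← nevanlinnaFactor_neg_add_zero,
        show Finset.univ.filter (fun s : SignType => s ≠ 1) = {.neg, .zero} by decide,
        Finset.sum_insert (by decide), Finset.sum_singleton]
    simp only [h2]
    rw [Finset.prod_univ_sum]
    refine Finset.sum_congr ?_ fun _ _ => rfl
    ext ρ
    simp [Fintype.mem_piFinset]
  simp only [kernel_eq, h1]
  rw [integral_const_mul, integral_sub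
    ((integrable_finsetSum _ fun ρ _ => hμ.integrable_nevanlinna ρ hz').const_mul 2)
    (hμ.integrable_nevanlinna (fun _ => .zero) hz'), integral_const_mul,
    integral_finsetSum _ fun ρ _ => hμ.integrable_nevanlinna ρ hz']
  rfl

lemma ofReal_integral_poisson_eq {μ : Measure (Fin n → ℝ)} (hμ : GrowthCondition μ)
    {z : Fin n → ℂ} (hz : z ∈ polyUpperHalfPlane n) :
    ((∫ t : Fin n → ℝ, ∏ l, (z l).im / ‖(t l : ℂ) - z l‖ ^ 2 ∂μ : ℝ) : ℂ) =
      ∑ ρ, nevanlinnaIntegral μ ρ z := by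
  have hz' := polyUpperHalfPlane_subset hz
  rw [← integral_complex_ofReal]
  simp only [nevanlinnaIntegral]
  rw [← integral_finsetSum _ fun ρ _ => hμ.integrable_nevanlinna ρ hz']
  refine integral_congr_ae (ae_of_all _ fun t => ?_)
  simp only
  rw [Complex.ofReal_prod, ← Fintype.piFinset_univ,
    ← Finset.prod_univ_sum (fun _ => Finset.univ) (fun l s => nevanlinnaFactor s (z l) (t l))]
  exact Finset.prod_congr rfl fun l _ => (sum_nevanlinnaFactor (hz' l) (t l)).symm

lemma sum_nevanlinnaIntegral_eq (μ : Measure (Fin n → ℝ)) (z : Fin n → ℂ) :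
    ∑ ρ, nevanlinnaIntegral μ ρ z = ∑ ρ ∈ mixedSigns n, nevanlinnaIntegral μ ρ z
      + ∑ ρ with ∀ k, ρ k ≠ 1, nevanlinnaIntegral μ ρ z
      + conj (∑ ρ with ∀ k, ρ k ≠ 1, nevanlinnaIntegral μ ρ z) - nevanlinnaIntegral μ 0 z := by
  have h1 : conj (∑ ρ with ∀ k, ρ k ≠ 1, nevanlinnaIntegral μ ρ z) =
      ∑ ρ with ∀ k, ρ k ≠ -1, nevanlinnaIntegral μ ρ z := by
    rw [map_sum]
    simp only [← nevanlinnaIntegral_neg]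
    refine Finset.sum_equiv (Equiv.neg _) (fun ρ => ?_) (fun _ _ => rfl)
    simp [neg_eq_iff_eq_neg]
  have h2 : nevanlinnaIntegral μ 0 z =
      ∑ ρ, if ρ = (0 : Fin n → SignType) then nevanlinnaIntegral μ ρ z else 0 := by
    rw [Finset.sum_ite_eq' Finset.univ (0 : Fin n → SignType)]
    simp
  rw [h1, h2]
  simp only [mixedSigns, Finset.sum_filter, ← Finset.sum_add_distrib, ← Finset.sum_sub_distrib]
  refine Finset.sum_congr rfl fun ρ _ => ?_
  by_cases hm : ∃ j, ρ j = -1 <;> by_cases hp : ∃ j, ρ j = 1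
  · have h0 : ρ ≠ 0 := by rintro rfl; obtain ⟨j, hj⟩ := hm; revert hj; simp
    have hp' : ¬ ∀ k, ρ k ≠ 1 := by simpa using hp
    have hm' : ¬ ∀ k, ρ k ≠ -1 := by simpa using hm
    rw [if_pos ⟨hm, hp⟩, if_neg hp', if_neg hm', if_neg h0]
    ring
  · have h0 : ρ ≠ 0 := by rintro rfl; obtain ⟨j, hj⟩ := hm; revert hj; simp
    have hp' : ∀ k, ρ k ≠ 1 := by simpa using hp
    have hm' : ¬ ∀ k, ρ k ≠ -1 := by simpa using hm
    rw [if_neg (fun h => hp h.2), if_pos hp', if_neg hm', if_neg h0]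
    ring
  · have h0 : ρ ≠ 0 := by rintro rfl; obtain ⟨j, hj⟩ := hp; revert hj; simp
    have hp' : ¬ ∀ k, ρ k ≠ 1 := by simpa using hp
    have hm' : ∀ k, ρ k ≠ -1 := by simpa using hm
    rw [if_neg (fun h => hm h.1), if_neg hp', if_pos hm', if_neg h0]
    ring
  · have hp' : ∀ k, ρ k ≠ 1 := by simpa using hp
    have hm' : ∀ k, ρ k ≠ -1 := by simpa using hm
    have h0 : ρ = 0 := by
      funext k
      have h1 := hp' k
      have h2 := hm' k
      rcases hs : ρ k with _ | _ | _
      · rfl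
      · exact absurd hs h2
      · exact absurd hs h1
    rw [if_neg (fun h => hm h.1), if_pos hp', if_pos hm', if_pos h0]
    ring

lemma nevanlinnaIntegral_I (μ : Measure (Fin n → ℝ)) {ρ : Fin n → SignType} (hρ : ρ ≠ 0) :
    nevanlinnaIntegral μ ρ (fun _ => I) = 0 := by
  obtain ⟨k, hk⟩ := Function.ne_iff.mp hρ
  have := nevanlinnaIntegral_update_I μ (k := k) hk (fun _ => I)
  rwa [Function.update_eq_self_iff.mpr rfl] at this

/-- If twice the real part of a holomorphic function `L` is the sum of the Nevanlinna condition,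
then `L` is constant, since every term of the sum has both a holomorphic and an antiholomorphic
factor. -/
lemma eq_const_of_sum_mixedSigns_eq {μ : Measure (Fin n → ℝ)} (hμ : GrowthCondition μ)
    {L : (Fin n → ℂ) → ℂ}
    (hL : ∀ k, ∀ z ∈ polyUpperHalfPlane n, ∀ w : ℂ, 0 < w.im →
      DifferentiableAt ℂ (fun w => L (Function.update z k w)) w)
    (hsum : ∀ z ∈ polyUpperHalfPlane n,
      ∑ ρ ∈ mixedSigns n, nevanlinnaIntegral μ ρ z = L z + conj (L z)) :
    ∀ z ∈ polyUpperHalfPlane n, L z = L fun _ => I := by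
  have hstep : ∀ j, ∀ z ∈ polyUpperHalfPlane n, L z = L (Function.update z j I) := by
    intro j z hz
    have h1 := sum_filter_eq_one_eq hμ (hL j) (hL j) hsum
    have h2 : ∀ z ∈ polyUpperHalfPlane n,
        ∑ ρ ∈ ((mixedSigns n).filter fun ρ => ρ j = 1).map (Equiv.neg _).toEmbedding,
          nevanlinnaIntegral μ ρ z = L z - L (Function.update z j I) := by
      intro z hz
      rw [Finset.sum_map]
      simp only [Equiv.coe_toEmbedding, Equiv.neg_apply, nevanlinnaIntegral_neg, ← map_sum]
      rw [h1 z hz, conj_conj]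
    have h3 := sum_filter_forall_ne_one_eq hμ (fun k z hz w hw => ?_) h2 z hz
    · rw [Finset.sum_eq_zero] at h3
      · exact (sub_eq_zero.mp h3.symm)
      · intro ρ hρ
        exfalso
        simp only [mixedSigns, Finset.mem_filter, Finset.mem_map, Finset.mem_univ, true_and] at hρ
        obtain ⟨⟨σ, ⟨⟨⟨k, hk⟩, _⟩, _⟩, rfl⟩, hρ⟩ := hρ
        exact hρ k (by simp [hk])
    · refine (hL k z hz w hw).sub ?_
      rcases eq_or_ne k j with rfl | h
      · simp only [Function.update_idem]
        exact differentiableAt_const _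
      · simp only [Function.update_comm h]
        exact hL k _ (update_mem_polyUpperHalfPlane hz j (by simp)) w hw
  intro z hz
  suffices ∀ s : Finset (Fin n), L z = L fun l => if l ∈ s then I else z l by
    simpa using this Finset.univ
  intro s
  induction s using Finset.induction_on with
  | empty => simp
  | insert j s _ ih =>
    have hmem : (fun l => if l ∈ s then I else z l) ∈ polyUpperHalfPlane n := by
      intro l
      by_cases h : l ∈ s
      · simp [h]
      · simpa [h] using hz l
    rw [ih, hstep j _ hmem]
    congr 1
    funext l
    rcases eq_or_ne l j with rfl | h
    · simp
    · simp [h]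

/-- The Herglotz–Nevanlinna integral representation without linear term, for functions of sublinear
growth. -/
theorem exists_isRepresentedBy {f : (Fin n → ℂ) → ℂ}
    (hf : DifferentiableOn ℂ f (polyUpperHalfPlane n))
    (hpos : ∀ z ∈ polyUpperHalfPlane n, 0 ≤ (f z).im) (hgrowth : HasSublinearGrowth f) :
    ∃ (a : ℝ) (μ : Measure (Fin n → ℝ)), IsRepresentedBy f a 0 μ := by
  obtain ⟨μ, hμ, hpoisson⟩ := exists_measure_im_eq_integral_poisson hf hpos fun j =>
    hgrowth.tendsto_im_div j (polyUpperHalfPlane_subset I_mem_polyUpperHalfPlane)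
  set p : ℂ := 1 / (Real.pi : ℂ) ^ n
  have hp0 : p ≠ 0 := by simp [p, Real.pi_ne_zero]
  have hpc : conj p = p := by simp [p]
  set S : (Fin n → ℂ) → ℂ := fun z => ∑ ρ with ∀ k, ρ k ≠ 1, nevanlinnaIntegral μ ρ z
  set F₀ : (Fin n → ℂ) → ℂ := nevanlinnaIntegral μ 0
  have hF₀ : ∀ z, conj (F₀ z) = F₀ z := fun z => by
    simp only [F₀]
    rw [← nevanlinnaIntegral_neg, neg_zero]
  -- `D` is the difference of `f` and the integral, the imaginary part of which is to vanish
  set D : (Fin n → ℂ) → ℂ := fun z => f z - p * (I * (2 * S z - F₀ z)) with hD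
  have hsum : ∀ z ∈ polyUpperHalfPlane n, ∑ ρ ∈ mixedSigns n, nevanlinnaIntegral μ ρ z =
      D z / (2 * I * p) + conj (D z / (2 * I * p)) := by
    intro z hz
    have h1 : ((f z).im : ℂ) = p * ∑ ρ, nevanlinnaIntegral μ ρ z := by
      rw [hpoisson z hz, ← ofReal_integral_poisson_eq hμ hz]
      simp [p]
    rw [sum_nevanlinnaIntegral_eq, Complex.im_eq_sub_conj] at h1
    simp only [hD, map_div₀, map_sub, map_mul, map_ofNat, conj_I, hpc, hF₀]
    have h2 : f z - conj (f z) = 2 * I * (p * (∑ ρ ∈ mixedSigns n, nevanlinnaIntegral μ ρ z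
        + S z + conj (S z) - F₀ z)) := by
      rw [← h1]
      field_simp
    have h3 : ∑ ρ ∈ mixedSigns n, nevanlinnaIntegral μ ρ z =
        (f z - conj (f z)) / (2 * I * p) - S z - conj (S z) + F₀ z := by
      rw [h2]
      field_simp
      ring
    rw [h3]
    field_simp
    ring
  have hLd : ∀ k, ∀ z ∈ polyUpperHalfPlane n, ∀ w : ℂ, 0 < w.im →
      DifferentiableAt ℂ (fun w => D (Function.update z k w) / (2 * I * p)) w := by
    intro k z hz w hw
    have h1 : DifferentiableAt ℂ (fun w => f (Function.update z k w)) w :=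
      (hf.differentiableAt (isOpen_polyUpperHalfPlane.mem_nhds
        (update_mem_polyUpperHalfPlane hz k hw))).comp w (hasFDerivAt_update z w).differentiableAt
    have h2 : DifferentiableAt ℂ (fun w => S (Function.update z k w)) w :=
      DifferentiableAt.fun_sum fun ρ hρ =>
        differentiableAt_nevanlinnaIntegral hμ ((Finset.mem_filter.mp hρ).2 k) hz hw
    have h3 : DifferentiableAt ℂ (fun w => F₀ (Function.update z k w)) w :=
      differentiableAt_nevanlinnaIntegral hμ (by simp) hz hw
    exact (h1.sub ((((h2.const_mul 2).sub h3).const_mul I).const_mul p)).div_const _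
  have hconst := eq_const_of_sum_mixedSigns_eq hμ hLd hsum
  have hI := hsum _ I_mem_polyUpperHalfPlane
  have hzero : ∑ ρ ∈ mixedSigns n, nevanlinnaIntegral μ ρ (fun _ => I) = 0 := by
    refine Finset.sum_eq_zero fun ρ hρ => nevanlinnaIntegral_I μ ?_
    rintro rfl
    obtain ⟨j, hj⟩ := (Finset.mem_filter.mp hρ).2.2
    revert hj
    simp
  rw [hzero] at hI
  have hreal : conj (D fun _ => I) = D fun _ => I := by
    simp only [map_div₀, map_mul, map_ofNat, conj_I, hpc] at hI
    field_simp at hI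
    rw [zero_mul, zero_mul, zero_mul] at hI
    linear_combination hI
  refine ⟨(D fun _ => I).re, μ, fun _ => le_rfl, hμ, fun z hz => ?_, fun z hz => ?_⟩
  · change ∑ ρ ∈ mixedSigns n, nevanlinnaIntegral μ ρ z = 0
    rw [hsum z hz, hconst z hz, ← hI]
  · have h1 : D z = D fun _ => I := by
      have := hconst z hz
      field_simp at this
      exact this
    rw [integralFormula, integral_kernel_eq hμ hz, Complex.conj_eq_iff_re.mp hreal, ← h1]
    simp only [hD, Pi.zero_apply, Complex.ofReal_zero, zero_mul, Finset.sum_const_zero, add_zero]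
    ring

end HerglotzNevanlinna

theorem theorem3p3 (n : ℕ) (hn : 1 ≤ n) (f : (Fin n → ℂ) → ℂ)
    (hf : DifferentiableOn ℂ f (HerglotzNevanlinna.polyCutPlane n))
    (hgrowth : HerglotzNevanlinna.HasSublinearGrowth f) :
    (∃ h : (Fin n → ℂ) → ℂ, HerglotzNevanlinna.IsHerglotzNevanlinna h ∧
        HerglotzNevanlinna.IsSymmetricExtension h f) ↔
      (∀ z ∈ HerglotzNevanlinna.polyUpperHalfPlane n, 0 ≤ (f z).im) ∧
        HerglotzNevanlinna.SymmetryFormula f ∧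
        HerglotzNevanlinna.VariableNonDependence f := by
  have hfu := hf.mono HerglotzNevanlinna.polyUpperHalfPlane_subset
  constructor
  · rintro ⟨h, hh, a, b, μ, hrep, heq⟩
    obtain rfl := HerglotzNevanlinna.coeff_eq_zero_of_hasSublinearGrowth hgrowth
      hrep.b_nonneg hrep.growth heq
    refine ⟨fun z hz => ?_, HerglotzNevanlinna.symmetryFormula_integralFormula hn hrep.growth heq,
      HerglotzNevanlinna.variableNonDependence_integralFormula hrep.growth hrep.nevanlinna heq⟩
    rw [heq (HerglotzNevanlinna.polyUpperHalfPlane_subset hz), ← hrep.eqOn hz]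
    exact hh.im_nonneg z hz
  · rintro ⟨hpos, hsym, hvar⟩
    obtain ⟨a, μ, hrep⟩ := HerglotzNevanlinna.exists_isRepresentedBy hfu hpos hgrowth
    refine ⟨f, ⟨hfu, hpos⟩, a, 0, μ, hrep, ?_⟩
    exact HerglotzNevanlinna.eqOn_polyCutPlane_of_eqOn_polyUpperHalfPlane hsym
      (HerglotzNevanlinna.symmetryFormula_integralFormula hn hrep.growth (Set.eqOn_refl _ _)) hvar
      (HerglotzNevanlinna.variableNonDependence_integralFormula hrep.growth hrep.nevanlinna
        (Set.eqOn_refl _ _))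
      hrep.eqOn
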